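/- Let $d\ge 1$ and $\rho_0>0$. Let $\mathcal P$ be a homogeneous Poisson point process of unit intensity on $\mathbb R^d\times\mathbb R^+$, where $\mathbb R^+=[0,\infty)$, viewed as a random locally finite set. Make the points of $\mathcal P$ the vertices of an oriented graph, with an edge $(X,T)\to(X',T')$ whenever the open Euclidean balls of radius $\rho_0$ centred at $X$ and $X'$ intersect and either $T<T'$, or $T=T'$ and $X$ strictly precedes $X'$ in the lexicographic order. Let $F_1$ be the set of roots (vertices with no incoming edge) and $G_1$ the set of offspring of these roots (endpoints of the edges that start in $F_1$). Remove $F_1\cup G_1$ from the vertex set and define $F_2,G_2$ in the same way for the restricted graph, and so on. The random parking measure $\xi$ in $\mathbb R^d$ is the projection of $\bigcup_{i\ge1}F_i$ on $\mathbb R^d$. It is a locally finite set, and the space of locally finite subsets of $\mathbb R^d$ carries the $\sigma$-algebra generated by the numbers of points in Borel sets. Then $\xi$ is a measurable random locally finite set (a point process) with the following properties. 1. (Stationarity) $x+\xi$ has the same law as $\xi$ for every $x\in\mathbb R^d$. 2. (Ergodicity) The law of $\xi$ is ergodic under the action of $\mathbb R^d$ by translations: every measurable set of configurations that is invariant, up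 to null sets of the law of $\xi$, under each translation has probability $0$ or $1$. In particular this holds for every strictly translation-invariant measurable set. 3. (Isotropy) $\mathbf R\xi$ has the same law as $\xi$ for every rotation $\mathbf R\in SO_d$. 4. (General position) Almost surely, no $d+1$ distinct points of $\xi$ lie in a common hyperplane, and no $d+2$ distinct points of $\xi$ lie on a common sphere. 5. (Admissibility) Almost surely, any two distinct points of $\xi$ are at distance at least $2\rho_0$ (hard-core condition), and every open ball of radius $2\rho_0$ in $\mathbb R^d$ contains a point of $\xi$ (non-empty space condition). Hence $\xi$ is an isotropic admissible stochastic lattice. -/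

import Mathlib

open MeasureTheory ProbabilityTheory Set
open scoped NNReal ENNReal

/-- The space `ℝᵈ` with its Euclidean norm. -/
abbrev Space (d : ℕ) : Type := EuclideanSpace ℝ (Fin d)

/-- Space-time `ℝᵈ × ℝ⁺`, where `ℝ⁺ = [0, ∞)`. -/
abbrev SpaceTime (d : ℕ) : Type := Space d × ℝ≥0

/-- Lebesgue measure on `ℝᵈ × ℝ⁺`. -/
noncomputable def spaceTimeVolume (d : ℕ) : Measure (SpaceTime d) :=
  (volume : Measure (Space d)).prod
    (Measure.comap (fun t : ℝ≥0 => (t : ℝ)) (volume : Measure ℝ))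

/-! ### Locally finite point sets -/

/-- Locally finite subsets of a metric space: only finitely many points in each bounded set. -/
@[ext]
structure LocFinSet (X : Type*) [PseudoMetricSpace X] where
  /-- the underlying set of points -/
  carrier : Set X
  finite_inter : ∀ B : Set X, Bornology.IsBounded B → (carrier ∩ B).Finite

namespace LocFinSet

section Basic

variable {X : Type*} [PseudoMetricSpace X]

/-- The number of points of `S` in `B`. -/
noncomputable def count (B : Set X) (S : LocFinSet X) : ℕ∞ := (S.carrier ∩ B).encard

/-- The sigma-algebra on locally finite sets generated by the counts in Borel sets. -/
noncomputable instance instMeasurableSpace [MeasurableSpace X] : MeasurableSpace (LocFinSet X) :=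
  ⨆ (B : Set X) (_ : MeasurableSet B), MeasurableSpace.comap (count B) inferInstance

/-- The image of a locally finite set under a surjective isometry. -/
def map (e : X ≃ᵢ X) (S : LocFinSet X) : LocFinSet X where
  carrier := e '' S.carrier
  finite_inter B hB := by
    have hb : Bornology.IsBounded (e.symm '' B) := e.symm.isometry.lipschitz.isBounded_image hB
    refine ((S.finite_inter _ hb).image e).subset ?_
    rintro _ ⟨⟨x, hx, rfl⟩, hxB⟩
    exact ⟨x, ⟨hx, e x, hxB, e.symm_apply_apply x⟩, rfl⟩

end Basic

/-- A set whose points are pairwise at distance at least `r > 0` is locally finite. -/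
theorem finite_inter_of_separated {X : Type*} [PseudoMetricSpace X] [ProperSpace X]
    {s : Set X} {r : ℝ} (hr : 0 < r) (hs : s.Pairwise fun x y => r ≤ dist x y)
    (B : Set X) (hB : Bornology.IsBounded B) : (s ∩ B).Finite := by
  obtain ⟨t, ht, hcov⟩ := Metric.totallyBounded_iff.1
    (Metric.isCompact_of_isClosed_isBounded isClosed_closure hB.closure
      |>.totallyBounded.subset subset_closure : TotallyBounded B) (r / 2) (half_pos hr)
  have hc : ∀ x ∈ s ∩ B, ∃ y ∈ t, dist x y < r / 2 := by
    intro x hx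
    simpa using hcov hx.2
  choose! f hf hfd using hc
  refine Set.Finite.of_injOn (f := f) (fun x hx => hf x hx) ?_ ht
  intro x hx y hy hxy
  by_contra hne
  have h1 := hs hx.1 hy.1 hne
  have h2 := dist_triangle_right x y (f x)
  have h3 := hfd x hx
  have h4 := hfd y hy
  rw [← hxy] at h4
  linarith

/-- `ℝᵈ` acts on locally finite subsets of `ℝᵈ` by translations `S ↦ x + S`. -/
noncomputable instance instVAdd {d : ℕ} : VAdd (Space d) (LocFinSet (Space d)) where
  vadd x S := S.map (IsometryEquiv.addLeft x)

end LocFinSet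

/-! ### Poisson processes -/

/-- `Φ`, a random locally finite set on the probability space `(Ω, P)`, is a Poisson point process
with intensity measure `μ`: the number of points in a Borel set `B` of finite `μ`-measure has the
Poisson law of parameter `μ B`, and the numbers of points in pairwise disjoint Borel sets are
independent. -/
structure IsPoissonProcess {Ω X : Type*} [MeasurableSpace Ω] [PseudoMetricSpace X]
    [MeasurableSpace X] (P : Measure Ω) (μ : Measure X) (Φ : Ω → LocFinSet X) : Prop where
  measurable : Measurable Φ
  map_count : ∀ B : Set X, MeasurableSet B → μ B ≠ ∞ →
    P.map (fun ω => (Φ ω).count B)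
      = (poissonMeasure (μ B).toNNReal).map (fun n : ℕ => (n : ℕ∞))
  iIndepFun_count : ∀ (n : ℕ) (B : Fin n → Set X), (∀ i, MeasurableSet (B i)) →
    Pairwise (fun i j => Disjoint (B i) (B j)) →
    iIndepFun (fun i ω => (Φ ω).count (B i)) P

/-! ### The graphical construction of random parking -/

namespace Parking

variable {d : ℕ}

/-- Strict lexicographic order on `ℝᵈ`. -/
def LexLT (x y : Space d) : Prop := ∃ i, (∀ j < i, x j = y j) ∧ x i < y i

/-- There is an oriented edge from `p` to `q`: the open balls of radius `ρ` around the spatial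
positions overlap, and `p` arrives before `q` (ties are broken lexicographically). -/
def Edge (ρ : ℝ) (p q : SpaceTime d) : Prop :=
  (Metric.ball p.1 ρ ∩ Metric.ball q.1 ρ).Nonempty ∧
    (p.2 < q.2 ∨ (p.2 = q.2 ∧ LexLT p.1 q.1))

/-- The roots of the graph restricted to the vertex set `V`. -/
def roots (ρ : ℝ) (V : Set (SpaceTime d)) : Set (SpaceTime d) :=
  {p ∈ V | ∀ q ∈ V, ¬ Edge ρ q p}

/-- The vertices in `V` that are offspring of a root of the graph restricted to `V`. -/
def offspring (ρ : ℝ) (V : Set (SpaceTime d)) : Set (SpaceTime d) :=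
  {p ∈ V | ∃ q ∈ roots ρ V, Edge ρ q p}

/-- The vertices that remain after `n` steps; each step removes the current roots and their
offspring. -/
def remaining (ρ : ℝ) (V : Set (SpaceTime d)) : ℕ → Set (SpaceTime d)
  | 0 => V
  | n + 1 => remaining ρ V n \ (roots ρ (remaining ρ V n) ∪ offspring ρ (remaining ρ V n))

/-- The accepted space-time points: the union over all steps of the sets of roots. -/
def accepted (ρ : ℝ) (V : Set (SpaceTime d)) : Set (SpaceTime d) :=
  ⋃ n, roots ρ (remaining ρ V n)

theorem remaining_antitone (ρ : ℝ) (V : Set (SpaceTime d)) : Antitone (remaining ρ V) :=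
  antitone_nat_of_succ_le fun _ => Set.sdiff_subset

/-- Of two distinct points whose balls overlap, one is a parent of the other. -/
theorem edge_or_edge {ρ : ℝ} {p q : SpaceTime d}
    (h : (Metric.ball p.1 ρ ∩ Metric.ball q.1 ρ).Nonempty) (hne : p ≠ q) :
    Edge ρ p q ∨ Edge ρ q p := by
  have h' : (Metric.ball q.1 ρ ∩ Metric.ball p.1 ρ).Nonempty := by rwa [Set.inter_comm]
  rcases lt_trichotomy p.2 q.2 with ht | ht | ht
  · exact Or.inl ⟨h, Or.inl ht⟩
  · have hx : p.1 ≠ q.1 := fun hx => hne (Prod.ext hx ht)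
    have hfun : (fun i => p.1 i) ≠ fun i => q.1 i := by
      intro hf
      apply hx
      ext i
      exact congrFun hf i
    obtain hl | hl := lt_or_gt_of_ne (fun hl => hfun (toLex.injective hl) :
      toLex (fun i => p.1 i) ≠ toLex (fun i => q.1 i))
    · obtain ⟨i, hi, hi'⟩ := hl
      exact Or.inl ⟨h, Or.inr ⟨ht, i, hi, hi'⟩⟩
    · obtain ⟨i, hi, hi'⟩ := hl
      exact Or.inr ⟨h', Or.inr ⟨ht.symm, i, hi, hi'⟩⟩
  · exact Or.inr ⟨h', Or.inl ht⟩

/-- There is no edge between two accepted points. -/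
theorem not_edge_of_accepted {ρ : ℝ} {V : Set (SpaceTime d)} {p q : SpaceTime d}
    (hp : p ∈ accepted ρ V) (hq : q ∈ accepted ρ V) : ¬ Edge ρ p q := by
  intro he
  obtain ⟨m, hm⟩ := Set.mem_iUnion.1 hp
  obtain ⟨n, hn⟩ := Set.mem_iUnion.1 hq
  rcases le_or_gt n m with hnm | hmn
  · exact hn.2 p (remaining_antitone ρ V hnm hm.1) he
  · have h1 : q ∈ remaining ρ V (m + 1) := remaining_antitone ρ V hmn hn.1
    have h2 : q ∈ remaining ρ V m := remaining_antitone ρ V (Nat.le_succ m) h1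
    exact h1.2 (Or.inr ⟨h2, p, hm, he⟩)

/-- The balls around two distinct accepted points do not overlap. -/
theorem accepted_separated (ρ : ℝ) (V : Set (SpaceTime d)) :
    (Prod.fst '' accepted ρ V).Pairwise fun x y => 2 * ρ ≤ dist x y := by
  rintro _ ⟨p, hp, rfl⟩ _ ⟨q, hq, rfl⟩ hne
  by_contra! hlt
  have hb : (Metric.ball p.1 ρ ∩ Metric.ball q.1 ρ).Nonempty := by
    refine ⟨midpoint ℝ p.1 q.1, ?_, ?_⟩
    · rw [Metric.mem_ball, dist_midpoint_left, Real.norm_ofNat]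
      linarith
    · rw [Metric.mem_ball, dist_midpoint_right, Real.norm_ofNat]
      linarith
  rcases edge_or_edge hb (fun h => hne (congrArg Prod.fst h)) with he | he
  · exact not_edge_of_accepted hp hq he
  · exact not_edge_of_accepted hq hp he

/-- The parking point set in `ℝᵈ` produced by balls of radius `ρ > 0` from the set `V` of
space-time arrivals: the projection on `ℝᵈ` of the accepted points. -/
noncomputable def parkingSet {ρ : ℝ} (hρ : 0 < ρ) (V : LocFinSet (SpaceTime d)) : LocFinSet (Space d) where
  carrier := Prod.fst '' accepted ρ V.carrier
  finite_inter := LocFinSet.finite_inter_of_separated (mul_pos two_pos hρ)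
    (accepted_separated ρ V.carrier)

end Parking

/-! ### Properties of point sets and of point processes -/

/-- `S` is in general position: no `d + 1` of its points lie in a hyperplane, and no `d + 2` of its
points lie on a sphere. -/
def IsGeneral {d : ℕ} (S : Set (Space d)) : Prop :=
  (∀ s : Finset (Space d), (s : Set (Space d)) ⊆ S → s.card = d + 1 →
    ¬ ∃ (a : Space d) (b : ℝ), a ≠ 0 ∧ ∀ x ∈ s, inner ℝ a x = b) ∧
  (∀ s : Finset (Space d), (s : Set (Space d)) ⊆ S → s.card = d + 2 →
    ¬ EuclideanGeometry.Cospherical (s : Set (Space d)))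

/-- `S` is `(ρ₁, ρ₂)`-admissible in `ℝᵈ`: distinct points of `S` are at distance at least `ρ₁`
(hard-core condition), and every open ball of radius `ρ₂` contains a point of `S` (non-empty space
condition). -/
def IsAdmissible {d : ℕ} (ρ₁ ρ₂ : ℝ) (S : Set (Space d)) : Prop :=
  (∀ x ∈ S, ∀ y ∈ S, x ≠ y → ρ₁ ≤ dist x y) ∧
  (∀ z : Space d, (Metric.ball z ρ₂ ∩ S).Nonempty)

namespace PointProcess

/-- Stationarity under real shifts: `x + ξ` has the same law as `ξ` for every `x ∈ ℝᵈ`. -/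
def IsStationary {Ω : Type*} [MeasurableSpace Ω] {d : ℕ} (P : Measure Ω)
    (ξ : Ω → LocFinSet (Space d)) : Prop :=
  ∀ x : Space d, P.map (fun ω => x +ᵥ ξ ω) = P.map ξ

/-- Isotropy: `R ξ` has the same law as `ξ` for every rotation `R`, that is, for every linear
isometry of `ℝᵈ` with determinant `1`. -/
def IsIsotropic {Ω : Type*} [MeasurableSpace Ω] {d : ℕ} (P : Measure Ω)
    (ξ : Ω → LocFinSet (Space d)) : Prop :=
  ∀ R : Space d ≃ₗᵢ[ℝ] Space d, LinearMap.det (R.toLinearEquiv : Space d →ₗ[ℝ] Space d) = 1 →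
    P.map (fun ω => (ξ ω).map R.toIsometryEquiv) = P.map ξ

end PointProcess

/-! ### Measurable structure of the space of locally finite sets -/

namespace LocFinSet

/-! The parking set is a measurable function of the Poisson process that commutes with translations.
It also commutes with rotations as long as no two arrival times coincide, which holds almost surely.
The law of a Poisson process is determined by its intensity (`IsPoissonProcess.map_eq`), and
Lebesgue measure is invariant under isometries, so stationarity and isotropy pass to the parking
set. Ergodicity passes to it from a zero-one law for the Poisson process
(`measure_eq_zero_or_one_of_invariant`): an event is approximated by one that depends on a bounded
region only, and such an event is independent of its image under a far translation.

The finer almost sure statements rest on a first-moment bound, `measure_exists_injective_le`: some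
tuple of distinct Poisson points lies in `A` with probability at most the product measure of `A`.
For null `A` it excludes simultaneous arrivals and tuples in special position. Applied to chains of
`n` successive earlier neighbours it gives a bound of order `(c T) ^ n / n!`, so every arrival is
accepted or rejected after finitely many rounds.

The hard-core condition is deterministic (`accepted_separated`). For the non-empty space condition,
arrivals over an unbounded time are dense in space and each lies within `2ρ` of an accepted point,
so the open `2ρ`-balls around the parking set cover a dense set. A point `z` left uncovered must lie
in the convex hull of the parking points at distance exactly `2ρ` from it; otherwise `z` could be
moved away from all of them into an uncovered open set. Such tuples form a null set
(`volume_centredTuples`). -/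

theorem count_map {X : Type*} [PseudoMetricSpace X] (e : X ≃ᵢ X) (B : Set X) (S : LocFinSet X) :
    count B (map e S) = count (e ⁻¹' B) S := by
  have : (map e S).carrier ∩ B = e '' (S.carrier ∩ e ⁻¹' B) := by
    rw [image_inter_preimage]; rfl
  rw [count, this, e.injective.encard_image, count]

theorem count_lt_top {X : Type*} [PseudoMetricSpace X] (S : LocFinSet X) {B : Set X}
    (hB : Bornology.IsBounded B) : count B S < ⊤ :=
  Set.encard_lt_top_iff.2 (S.finite_inter B hB)

theorem countable_carrier {X : Type*} [PseudoMetricSpace X] (S : LocFinSet X) :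
    S.carrier.Countable := by
  rcases isEmpty_or_nonempty X with h | ⟨⟨x⟩⟩
  · exact Set.to_countable _
  · have : S.carrier = ⋃ n : ℕ, S.carrier ∩ Metric.closedBall x n := by
      rw [← inter_iUnion, Metric.iUnion_closedBall_nat, inter_univ]
    rw [this]
    exact countable_iUnion fun n => (S.finite_inter _ Metric.isBounded_closedBall).countable

section Measurability

variable {X : Type*} [MetricSpace X] [MeasurableSpace X]

theorem measurable_count {B : Set X} (hB : MeasurableSet B) : Measurable (count B) :=
  Measurable.of_comap_le (le_iSup₂_of_le B hB le_rfl)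

theorem measurable_of_measurable_count {Ω : Type*} [MeasurableSpace Ω] {f : Ω → LocFinSet X}
    (hf : ∀ B, MeasurableSet B → Measurable fun ω => count B (f ω)) : Measurable f := by
  refine Measurable.of_le_map (iSup₂_le fun B hB => ?_)
  rintro _ ⟨s, hs, rfl⟩
  exact hf B hB hs

theorem measurable_map [BorelSpace X] (e : X ≃ᵢ X) : Measurable (map e) := by
  refine measurable_of_measurable_count fun B hB => ?_
  simp only [count_map]
  exact measurable_count (e.continuous.measurable hB)

variable [BorelSpace X]

/-- The counting measure of a locally finite set. -/
noncomputable def measure (S : LocFinSet X) : Measure X := Measure.count.restrict S.carrier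

theorem measure_apply (S : LocFinSet X) {B : Set X} (hB : MeasurableSet B) :
    S.measure B = (count B S : ℝ≥0∞) := by
  rw [measure, Measure.restrict_apply hB,
    Measure.count_apply (hB.inter S.countable_carrier.measurableSet), count, inter_comm]

theorem measure_apply_eq_zero (S : LocFinSet X) (B : Set X) :
    S.measure B = 0 ↔ S.carrier ∩ B = ∅ := by
  rw [measure, Measure.restrict_apply' S.countable_carrier.measurableSet,
    Measure.count_eq_zero_iff, inter_comm]

variable (X) in
/-- The kernel that maps a locally finite set to its counting measure. -/
noncomputable def kernel : Kernel (LocFinSet X) X where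
  toFun := measure
  measurable' := by
    refine Measure.measurable_of_measurable_coe _ fun B hB => ?_
    simp only [fun S => measure_apply S hB]
    exact (Measurable.of_discrete (f := fun n : ℕ∞ => (n : ℝ≥0∞))).comp (measurable_count hB)

theorem kernel_apply (S : LocFinSet X) : kernel X S = S.measure := rfl

/-- A configuration can have arbitrarily many points in a fixed bounded set, so no uniform bound on
the mass is available. Splitting the parameter space by the integer part of the total mass gives
countably many finite kernels. -/
theorem isSFiniteKernel_of_isFiniteMeasure {α β : Type*} [MeasurableSpace α] [MeasurableSpace β]
    (κ : Kernel α β) [∀ a, IsFiniteMeasure (κ a)] : IsSFiniteKernel κ := by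
  classical
  have hm : ∀ n : ℕ, MeasurableSet {a | κ a univ ∈ Ico (n : ℝ≥0∞) (n + 1)} := fun n =>
    (κ.measurable_coe MeasurableSet.univ) measurableSet_Ico
  have hf : ∀ n : ℕ, IsFiniteKernel (Kernel.piecewise (hm n) κ 0) := fun n => by
    refine ⟨⟨n + 1, by finiteness, fun a => ?_⟩⟩
    rw [Kernel.piecewise_apply]
    split_ifs with h
    · exact h.2.le
    · simp
  have : κ = Kernel.sum fun n : ℕ => Kernel.piecewise (hm n) κ 0 := by
    ext a s hs
    rw [Kernel.sum_apply' _ _ hs]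
    obtain ⟨n, hn⟩ : ∃ n : ℕ, κ a univ ∈ Ico (n : ℝ≥0∞) (n + 1) := by
      lift κ a univ to ℝ≥0 using measure_ne_top (κ a) univ with r
      refine ⟨⌊r⌋₊, ?_, ?_⟩
      · exact_mod_cast Nat.floor_le r.2
      · exact_mod_cast Nat.lt_floor_add_one r
    rw [tsum_eq_single n]
    · rw [Kernel.piecewise_apply]; simp only [mem_ofPred_eq, if_pos hn]
    · intro m hmn
      have hm : ¬ κ a univ ∈ Ico (m : ℝ≥0∞) (m + 1) := by
        intro hm'
        have h1 := hm'.1.trans_lt hn.2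
        have h2 := hn.1.trans_lt hm'.2
        have h1' : m < n + 1 := by exact_mod_cast h1
        have h2' : n < m + 1 := by exact_mod_cast h2
        omega
      rw [Kernel.piecewise_apply]
      simp only [mem_ofPred_eq, if_neg hm, zero_apply, Measure.coe_zero, Pi.zero_apply]
  rw [this]
  infer_instance

/-- S-finiteness is what makes the measure of a section depend measurably on the configuration. The
space is cut into bounded shells, on each of which every configuration has finite mass. -/
instance : IsSFiniteKernel (kernel X) := by
  rcases isEmpty_or_nonempty X with h | ⟨⟨x⟩⟩
  · have : kernel X = 0 := by
      ext a s hs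
      simp [Set.eq_empty_of_isEmpty s]
    rw [this]; infer_instance
  have hb : ∀ n : ℕ, MeasurableSet (disjointed (fun n : ℕ => Metric.closedBall x n) n) := fun n =>
    MeasurableSet.disjointed (fun n => Metric.isClosed_closedBall.measurableSet) n
  have hfin : ∀ n S, IsFiniteMeasure (Kernel.restrict (kernel X) (hb n) S) := fun n S => by
    refine ⟨?_⟩
    rw [Kernel.restrict_apply, Measure.restrict_apply_univ, kernel_apply, measure_apply _ (hb n)]
    exact_mod_cast S.count_lt_top (Metric.isBounded_closedBall.subset (disjointed_subset _ n))
  have hs : ∀ n, IsSFiniteKernel (Kernel.restrict (kernel X) (hb n)) := fun n =>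
    isSFiniteKernel_of_isFiniteMeasure _
  have : kernel X = Kernel.sum fun n => Kernel.restrict (kernel X) (hb n) := by
    ext S s hs
    rw [Kernel.sum_apply' _ _ hs]
    simp only [Kernel.restrict_apply]
    rw [← Measure.sum_apply _ hs, ← Measure.restrict_iUnion (disjoint_disjointed _) hb,
      iUnion_disjointed, Metric.iUnion_closedBall_nat, Measure.restrict_univ]
  rw [this]
  infer_instance

theorem measurableEmbedding_enatCast : MeasurableEmbedding (fun n : ℕ∞ => (n : ℝ≥0∞)) :=
  ⟨fun a b hab => by simpa using hab, .of_discrete,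
    fun {s} _ => (s.to_countable.image _).measurableSet⟩

/-- The number of points `p` of `S` for which `(y, p)` lies in a measurable set depends measurably
on `S` and `y`. -/
theorem measurable_measure_section {Y : Type*} [MeasurableSpace Y] {A : Set ((Y × LocFinSet X) × X)}
    (hA : MeasurableSet A) :
    Measurable fun z : Y × LocFinSet X => z.2.measure {p | (z, p) ∈ A} :=
  Kernel.measurable_kernel_prodMk_left (κ := (kernel X).comap Prod.snd measurable_snd) hA

end Measurability

end LocFinSet

/-! ### Measurability of the parking construction -/

namespace Parking

variable {d : ℕ}

theorem measurableSet_lexLT : MeasurableSet {p : Space d × Space d | LexLT p.1 p.2} := by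
  have : {p : Space d × Space d | LexLT p.1 p.2} =
      ⋃ i, (⋂ j : Fin d, ⋂ _ : j < i, {p | p.1 j = p.2 j}) ∩ {p | p.1 i < p.2 i} := by
    ext p; simp [LexLT]
  have hm : ∀ i : Fin d, Measurable fun x : Space d => x i := fun i => by fun_prop
  rw [this]
  refine MeasurableSet.iUnion fun i => MeasurableSet.inter (MeasurableSet.iInter fun j =>
    MeasurableSet.iInter fun _ => measurableSet_eq_fun ((hm j).comp measurable_fst)
      ((hm j).comp measurable_snd))
    (measurableSet_lt (by fun_prop) (by fun_prop))

theorem ball_inter_ball_nonempty_iff {ρ : ℝ} {x y : Space d} :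
    (Metric.ball x ρ ∩ Metric.ball y ρ).Nonempty ↔ dist x y < 2 * ρ := by
  constructor
  · rintro ⟨z, hx, hy⟩
    rw [Metric.mem_ball] at hx hy
    have := dist_triangle_left x y z
    linarith
  · intro h
    refine ⟨midpoint ℝ x y, ?_, ?_⟩
    · rw [Metric.mem_ball, dist_midpoint_left, Real.norm_ofNat]; linarith
    · rw [Metric.mem_ball, dist_midpoint_right, Real.norm_ofNat]; linarith

theorem edge_iff {ρ : ℝ} {p q : SpaceTime d} :
    Edge ρ p q ↔ dist p.1 q.1 < 2 * ρ ∧ (p.2 < q.2 ∨ (p.2 = q.2 ∧ LexLT p.1 q.1)) := by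
  rw [Edge, ball_inter_ball_nonempty_iff]

theorem measurableSet_edge (ρ : ℝ) :
    MeasurableSet {p : SpaceTime d × SpaceTime d | Edge ρ p.1 p.2} := by
  have h1 : MeasurableSet {p : SpaceTime d × SpaceTime d | dist p.1.1 p.2.1 < 2 * ρ} :=
    measurableSet_lt (measurable_fst.fst.dist measurable_snd.fst) measurable_const
  have h2 : MeasurableSet {p : SpaceTime d × SpaceTime d | p.1.2 < p.2.2} :=
    measurableSet_lt (f := fun p : SpaceTime d × SpaceTime d => p.1.2) (g := fun p => p.2.2)
      measurable_fst.snd measurable_snd.snd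
  have h3 : MeasurableSet {p : SpaceTime d × SpaceTime d | p.1.2 = p.2.2} :=
    measurableSet_eq_fun measurable_fst.snd measurable_snd.snd
  have h4 : MeasurableSet {p : SpaceTime d × SpaceTime d | LexLT p.1.1 p.2.1} :=
    (measurable_fst.fst.prodMk measurable_snd.fst) measurableSet_lexLT
  simp only [edge_iff]
  exact h1.inter (h2.union (h3.inter h4))

/-- A relation between configurations and points, restricted to the points of the configuration,
is measurable as a set of pairs. -/
def MeasurableVertices (A : LocFinSet (SpaceTime d) → Set (SpaceTime d)) : Prop :=
  (∀ V, A V ⊆ V.carrier) ∧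
    MeasurableSet {z : SpaceTime d × LocFinSet (SpaceTime d) | z.1 ∈ A z.2}

/-- The quantifier over `q` ranges over an uncountable space, but `q` is confined to the
configuration. Existence thus means that the counting measure of a measurable section is nonzero. -/
theorem measurableSet_exists_edge {A : LocFinSet (SpaceTime d) → Set (SpaceTime d)}
    (hA : MeasurableVertices A) {E : Set (SpaceTime d × SpaceTime d)} (hE : MeasurableSet E) :
    MeasurableSet {z : SpaceTime d × LocFinSet (SpaceTime d) | ∃ q ∈ A z.2, (q, z.1) ∈ E} := by
  have hm : MeasurableSet {w : (SpaceTime d × LocFinSet (SpaceTime d)) × SpaceTime d |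
      w.2 ∈ A w.1.2 ∧ (w.2, w.1.1) ∈ E} :=
    MeasurableSet.inter ((measurable_snd.prodMk measurable_fst.snd) hA.2)
      ((measurable_snd.prodMk measurable_fst.fst) hE)
  have := (LocFinSet.measurable_measure_section hm) (measurableSet_singleton (0 : ℝ≥0∞)).compl
  convert this using 1
  ext z
  simp only [mem_ofPred_eq, preimage_compl, mem_compl_iff, mem_preimage, mem_singleton_iff,
    LocFinSet.measure_apply_eq_zero, ← Set.nonempty_iff_ne_empty, ← ne_eq]
  exact ⟨fun ⟨q, hq, h⟩ => ⟨q, hA.1 _ hq, hq, h⟩, fun ⟨q, _, hq, h⟩ => ⟨q, hq, h⟩⟩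

theorem measurableVertices_carrier :
    MeasurableVertices (fun V : LocFinSet (SpaceTime d) => V.carrier) := by
  refine ⟨fun V => Subset.rfl, ?_⟩
  have hm : MeasurableSet {w : (SpaceTime d × LocFinSet (SpaceTime d)) × SpaceTime d |
      w.2 = w.1.1} := measurableSet_eq_fun measurable_snd measurable_fst.fst
  have := (LocFinSet.measurable_measure_section hm) (measurableSet_singleton (0 : ℝ≥0∞)).compl
  convert this using 1
  ext z
  simp [LocFinSet.measure_apply_eq_zero]

theorem MeasurableVertices.roots {A : LocFinSet (SpaceTime d) → Set (SpaceTime d)}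
    (hA : MeasurableVertices A) (ρ : ℝ) : MeasurableVertices (fun V => roots ρ (A V)) := by
  refine ⟨fun V p hp => hA.1 V hp.1, ?_⟩
  convert hA.2.diff (measurableSet_exists_edge hA (measurableSet_edge ρ)) using 1
  ext z
  simp [Parking.roots]

theorem MeasurableVertices.offspring {A : LocFinSet (SpaceTime d) → Set (SpaceTime d)}
    (hA : MeasurableVertices A) (ρ : ℝ) : MeasurableVertices (fun V => offspring ρ (A V)) := by
  refine ⟨fun V p hp => hA.1 V hp.1, ?_⟩
  exact hA.2.inter (measurableSet_exists_edge (hA.roots ρ) (measurableSet_edge ρ))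

theorem measurableVertices_remaining (ρ : ℝ) (n : ℕ) :
    MeasurableVertices (fun V : LocFinSet (SpaceTime d) => remaining ρ V.carrier n) := by
  induction n with
  | zero => exact measurableVertices_carrier
  | succ n ih =>
    refine ⟨fun V p hp => ih.1 V hp.1, ?_⟩
    exact ih.2.diff ((ih.roots ρ).2.union (ih.offspring ρ).2)

theorem measurableVertices_accepted (ρ : ℝ) :
    MeasurableVertices (fun V : LocFinSet (SpaceTime d) => accepted ρ V.carrier) := by
  refine ⟨fun V => iUnion_subset fun n => ((measurableVertices_remaining ρ n).roots ρ).1 V, ?_⟩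
  convert MeasurableSet.iUnion fun n => ((measurableVertices_remaining (d := d) ρ n).roots ρ).2
    using 1
  ext z
  simp [accepted]

theorem accepted_subset (ρ : ℝ) (V : Set (SpaceTime d)) : accepted ρ V ⊆ V :=
  iUnion_subset fun n _ hp => remaining_antitone ρ V (Nat.zero_le n) hp.1

theorem injOn_fst_accepted {ρ : ℝ} (hρ : 0 < ρ) (V : Set (SpaceTime d)) :
    InjOn Prod.fst (accepted ρ V) := by
  intro p hp q hq h
  by_contra hne
  have hb : (Metric.ball p.1 ρ ∩ Metric.ball q.1 ρ).Nonempty := by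
    rw [ball_inter_ball_nonempty_iff, h, dist_self]; positivity
  rcases edge_or_edge hb hne with he | he
  · exact not_edge_of_accepted hp hq he
  · exact not_edge_of_accepted hq hp he

theorem measurable_parkingSet {ρ : ℝ} (hρ : 0 < ρ) :
    Measurable (parkingSet hρ : LocFinSet (SpaceTime d) → LocFinSet (Space d)) := by
  refine LocFinSet.measurable_of_measurable_count fun B hB => ?_
  have hm : MeasurableSet {w : (Unit × LocFinSet (SpaceTime d)) × SpaceTime d |
      w.2 ∈ accepted ρ w.1.2.carrier ∧ w.2.1 ∈ B} :=
    MeasurableSet.inter ((measurable_snd.prodMk measurable_fst.snd)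
      (measurableVertices_accepted ρ).2) (measurable_snd.fst hB)
  have h := (LocFinSet.measurable_measure_section hm).comp
    (measurable_prodMk_left (β := LocFinSet (SpaceTime d)) (x := ()))
  rw [← LocFinSet.measurableEmbedding_enatCast.measurable_comp_iff]
  convert h using 1
  ext V
  have hm' : MeasurableSet {p : SpaceTime d | p ∈ accepted ρ V.carrier ∧ p.1 ∈ B} :=
    measurable_prodMk_left (x := ((), V)) hm
  -- The projection is injective on accepted points, so the points in `B` can be counted upstairs in
  -- space-time.
  have : (parkingSet hρ V).carrier ∩ B
      = Prod.fst '' (V.carrier ∩ {p : SpaceTime d | p ∈ accepted ρ V.carrier ∧ p.1 ∈ B}) := by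
    ext x
    constructor
    · rintro ⟨⟨p, hp, rfl⟩, hx⟩
      exact ⟨p, ⟨accepted_subset ρ _ hp, hp, hx⟩, rfl⟩
    · rintro ⟨p, ⟨_, hp, hx⟩, rfl⟩
      exact ⟨⟨p, hp, rfl⟩, hx⟩
  change _ = V.measure {p : SpaceTime d | p ∈ accepted ρ V.carrier ∧ p.1 ∈ B}
  rw [LocFinSet.measure_apply _ hm', Function.comp_apply, LocFinSet.count, LocFinSet.count, this,
    ((injOn_fst_accepted hρ V.carrier).mono fun p hp => hp.2.1).encard_image]

end Parking

/-! ### Poisson processes: finite-dimensional laws, uniqueness and mixing -/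

namespace LocFinSet

variable {X : Type*} [MetricSpace X] [MeasurableSpace X] [BorelSpace X]

theorem measurable_coe_count_iff {Ω : Type*} [MeasurableSpace Ω] {f : Ω → ℕ∞} :
    (Measurable fun ω => (f ω : ℝ≥0∞)) ↔ Measurable f :=
  measurableEmbedding_enatCast.measurable_comp_iff

variable (X) in
/-- The bounded Borel sets. -/
abbrev BoundedBorel : Type _ := {B : Set X // MeasurableSet B ∧ Bornology.IsBounded B}

/-- The family of the numbers of points in all bounded Borel sets. -/
noncomputable def counts (S : LocFinSet X) : BoundedBorel X → ℕ∞ := fun B => count B.1 S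

omit [BorelSpace X] in
theorem measurable_counts : Measurable (counts : LocFinSet X → BoundedBorel X → ℕ∞) :=
  measurable_pi_lambda _ fun B => measurable_count B.2.1

/-- Embeds the configuration space in a product of copies of `ℕ∞`, where cylinders and projective
limits are available. Bounded sets suffice because a count is the supremum of the counts in growing
balls; they are the sets on which the intensity will be finite. -/
theorem comap_counts :
    MeasurableSpace.comap (counts : LocFinSet X → BoundedBorel X → ℕ∞) MeasurableSpace.pi
      = instMeasurableSpace := by
  refine le_antisymm measurable_counts.comap_le (iSup₂_le fun B hB => ?_)
  obtain ⟨g, hg, hgB⟩ : ∃ g : (BoundedBorel X → ℕ∞) → ℝ≥0∞, Measurable g ∧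
      ∀ S, (count B S : ℝ≥0∞) = g (counts S) := by
    rcases isEmpty_or_nonempty X with h | ⟨⟨x⟩⟩
    · refine ⟨fun _ => 0, measurable_const, fun S => ?_⟩
      simp [count, Set.eq_empty_of_isEmpty]
    · have hm : ∀ n : ℕ, MeasurableSet (B ∩ Metric.closedBall x n) := fun n =>
        hB.inter Metric.isClosed_closedBall.measurableSet
      refine ⟨fun f => ⨆ n : ℕ, (f ⟨B ∩ Metric.closedBall x n, hm n,
        Metric.isBounded_closedBall.subset inter_subset_right⟩ : ℝ≥0∞), ?_, fun S => ?_⟩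
      · exact Measurable.iSup fun n => measurable_coe_count_iff.2 (measurable_pi_apply _)
      · simp only [counts, ← measure_apply S hB, ← measure_apply S (hm _)]
        rw [← Monotone.measure_iUnion, ← inter_iUnion, Metric.iUnion_closedBall_nat, inter_univ]
        intro m n hmn
        exact inter_subset_inter_right _
          (Metric.closedBall_subset_closedBall (by exact_mod_cast hmn))
  rintro _ ⟨s, -, rfl⟩
  refine ⟨g ⁻¹' ((fun n : ℕ∞ => (n : ℝ≥0∞)) '' s),
    hg (measurableEmbedding_enatCast.measurableSet_image' trivial), ?_⟩
  ext S
  simp only [mem_preimage, ← hgB]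
  exact measurableEmbedding_enatCast.injective.mem_set_image

theorem exists_counts_preimage {A : Set (LocFinSet X)} (hA : MeasurableSet A) :
    ∃ A' : Set (BoundedBorel X → ℕ∞), MeasurableSet A' ∧ counts ⁻¹' A' = A := by
  rw [← comap_counts] at hA
  exact hA

/-- The set of the points that belong to exactly the sets `B i` for `i ∈ s`. -/
def atom {X ι : Type*} (B : ι → Set X) (s : Set ι) : Set X := {x | {i | x ∈ B i} = s}

theorem measurableSet_atom {X ι : Type*} [MeasurableSpace X] [Finite ι] {B : ι → Set X}
    (hB : ∀ i, MeasurableSet (B i)) (s : Set ι) : MeasurableSet (atom B s) := by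
  have : atom B s = ⋂ i, {x | x ∈ B i ↔ i ∈ s} := by
    ext x; simp [atom, Set.ext_iff]
  rw [this]
  refine MeasurableSet.iInter fun i => ?_
  by_cases hi : i ∈ s
  · simpa [hi] using hB i
  · convert (hB i).compl using 1
    ext x
    simp [hi]

theorem disjoint_atom {X ι : Type*} {B : ι → Set X} {s t : Set ι} (hst : s ≠ t) :
    Disjoint (atom B s) (atom B t) :=
  Set.disjoint_left.2 fun _ hs ht => hst (hs.symm.trans ht)

theorem atom_subset {X ι : Type*} {B : ι → Set X} {s : Set ι} {i : ι} (hi : i ∈ s) :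
    atom B s ⊆ B i := fun x hx => by
  have : i ∈ {i | x ∈ B i} := by rw [show {i | x ∈ B i} = s from hx]; exact hi
  exact this

/-- The count of a set of a finite family as a sum of counts of atoms. -/
noncomputable def sumAtoms (ι : Type*) (f : {s : Set ι // s.Nonempty} → ℕ∞) (i : ι) : ℕ∞ :=
  ∑ᶠ s : {s : {s : Set ι // s.Nonempty} // i ∈ s.1}, f s.1

theorem measurable_sumAtoms (ι : Type*) [Finite ι] : Measurable (sumAtoms ι) := .of_discrete

/-- Reduces overlapping sets to disjoint ones, to which the Poisson axioms apply. The empty index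
set is left out because its atom is the complement of all `B i`, which may have infinite measure. -/
theorem count_eq_sumAtoms {X ι : Type*} [PseudoMetricSpace X] [Finite ι] {B : ι → Set X}
    (S : LocFinSet X) :
    (fun i => count (B i) S) = sumAtoms ι fun s => count (atom B s.1) S := by
  ext1 i
  have : S.carrier ∩ B i =
      ⋃ s : {s : {s : Set ι // s.Nonempty} // i ∈ s.1}, S.carrier ∩ atom B s.1.1 := by
    rw [← inter_iUnion]
    congr 1
    ext x
    simp only [mem_iUnion]
    constructor
    · intro hx
      exact ⟨⟨⟨{i | x ∈ B i}, ⟨i, hx⟩⟩, hx⟩, rfl⟩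
    · rintro ⟨s, hs⟩
      exact atom_subset s.2 hs
  rw [count, this, Set.encard_iUnion_of_finite]
  · rfl
  · intro s t hst
    refine (disjoint_atom fun h => hst (Subtype.ext (Subtype.ext h))).mono inter_subset_right
      inter_subset_right

end LocFinSet

namespace IsPoissonProcess

open LocFinSet

variable {Ω X : Type*} [MeasurableSpace Ω] [MetricSpace X] [MeasurableSpace X]
  {P : Measure Ω} {μ : Measure X} {Φ : Ω → LocFinSet X}

theorem measurable_count (h : IsPoissonProcess P μ Φ) {B : Set X} (hB : MeasurableSet B) :
    Measurable fun ω => count B (Φ ω) :=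
  (LocFinSet.measurable_count hB).comp h.measurable

theorem iIndepFun_count_of_finite (h : IsPoissonProcess P μ Φ) {ι : Type*} [Finite ι]
    {B : ι → Set X} (hB : ∀ i, MeasurableSet (B i))
    (hd : Pairwise fun i j => Disjoint (B i) (B j)) :
    iIndepFun (fun i ω => count (B i) (Φ ω)) P := by
  obtain ⟨n, ⟨e⟩⟩ := Finite.exists_equiv_fin ι
  have := h.iIndepFun_count n (B ∘ e.symm) (fun i => hB _)
    (fun i j hij => hd (e.symm.injective.ne hij))
  simpa using this.precomp e.injective

theorem map_counts_eq_pi [IsProbabilityMeasure P] (h : IsPoissonProcess P μ Φ) {ι : Type*} [Fintype ι]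
    {B : ι → Set X} (hB : ∀ i, MeasurableSet (B i)) (hd : Pairwise fun i j => Disjoint (B i) (B j))
    (hμ : ∀ i, μ (B i) ≠ ∞) :
    P.map (fun ω i => count (B i) (Φ ω)) =
      Measure.pi fun i => (poissonMeasure (μ (B i)).toNNReal).map (fun n : ℕ => (n : ℕ∞)) := by
  have := (iIndepFun_iff_map_fun_eq_pi_map fun i => (h.measurable_count (hB i)).aemeasurable).1
    (h.iIndepFun_count_of_finite hB hd)
  rw [this]
  congr 1
  ext1 i
  exact h.map_count _ (hB i) (hμ i)

theorem map_counts_eq_map_sumAtoms (h : IsPoissonProcess P μ Φ) {ι : Type*} [Finite ι]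
    {B : ι → Set X} (hB : ∀ i, MeasurableSet (B i)) :
    P.map (fun ω i => count (B i) (Φ ω)) =
      (P.map fun ω (s : {s : Set ι // s.Nonempty}) => count (atom B s.1) (Φ ω)).map
        (sumAtoms ι) := by
  rw [Measure.map_map (measurable_sumAtoms ι)
    (measurable_pi_lambda _ fun s => h.measurable_count (measurableSet_atom hB s.1))]
  exact congrArg (P.map ·) (funext fun ω => count_eq_sumAtoms (Φ ω))

theorem map_counts_eq [IsProbabilityMeasure P] {Ω' : Type*} [MeasurableSpace Ω'] {P' : Measure Ω'}
    [IsProbabilityMeasure P'] {Φ' : Ω' → LocFinSet X} (h : IsPoissonProcess P μ Φ)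
    (h' : IsPoissonProcess P' μ Φ') {ι : Type*} [Finite ι] {B : ι → Set X}
    (hB : ∀ i, MeasurableSet (B i)) (hμ : ∀ i, μ (B i) ≠ ∞) :
    P.map (fun ω i => count (B i) (Φ ω)) = P'.map (fun ω i => count (B i) (Φ' ω)) := by
  have := Fintype.ofFinite {s : Set ι // s.Nonempty}
  have hm : ∀ s : {s : Set ι // s.Nonempty}, MeasurableSet (atom B s.1) :=
    fun s => measurableSet_atom hB s.1
  have hd : Pairwise fun s t : {s : Set ι // s.Nonempty} => Disjoint (atom B s.1) (atom B t.1) :=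
    fun s t hst => disjoint_atom fun h => hst (Subtype.ext h)
  have hs : ∀ s : {s : Set ι // s.Nonempty}, μ (atom B s.1) ≠ ∞ := fun s => by
    obtain ⟨i, hi⟩ := s.2
    exact ne_top_of_le_ne_top (hμ i) (measure_mono (atom_subset hi))
  rw [h.map_counts_eq_map_sumAtoms hB, h'.map_counts_eq_map_sumAtoms hB,
    h.map_counts_eq_pi hm hd hs, h'.map_counts_eq_pi hm hd hs]

/-- The atoms of both families together are pairwise disjoint, so their counts are jointly
independent; each vector of counts is a function of its own block of atoms. -/
theorem indepFun_counts (h : IsPoissonProcess P μ Φ) {ι κ : Type*} [Finite ι] [Finite κ]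
    {B : ι → Set X} {C : κ → Set X} (hB : ∀ i, MeasurableSet (B i)) (hC : ∀ i, MeasurableSet (C i))
    (hBC : ∀ i j, Disjoint (B i) (C j)) :
    IndepFun (fun ω i => count (B i) (Φ ω)) (fun ω j => count (C j) (Φ ω)) P := by
  classical
  have := Fintype.ofFinite {s : Set ι // s.Nonempty}
  have := Fintype.ofFinite {s : Set κ // s.Nonempty}
  let D : {s : Set ι // s.Nonempty} ⊕ {s : Set κ // s.Nonempty} → Set X :=
    Sum.elim (fun s => atom B s.1) (fun s => atom C s.1)
  have hD : ∀ s, MeasurableSet (D s) := by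
    rintro (s | s)
    · exact measurableSet_atom hB s.1
    · exact measurableSet_atom hC s.1
  have hBC' : ∀ (s : {s : Set ι // s.Nonempty}) (t : {s : Set κ // s.Nonempty}),
      Disjoint (atom B s.1) (atom C t.1) := fun s t => by
    obtain ⟨i, hi⟩ := s.2
    obtain ⟨j, hj⟩ := t.2
    exact (hBC i j).mono (atom_subset hi) (atom_subset hj)
  have hd : Pairwise fun s t => Disjoint (D s) (D t) := by
    rintro (s | s) (t | t) hst
    · exact disjoint_atom fun h => hst (congrArg _ (Subtype.ext h))
    · exact hBC' s t
    · exact (hBC' t s).symm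
    · exact disjoint_atom fun h => hst (congrArg _ (Subtype.ext h))
  have hi := (h.iIndepFun_count_of_finite hD hd).indepFun_finset
    (Finset.univ.map Function.Embedding.inl) (Finset.univ.map Function.Embedding.inr)
    (by simp [Finset.disjoint_left]) (fun s => h.measurable_count (hD s))
  have hcB : (fun ω i => count (B i) (Φ ω))
      = fun ω => sumAtoms ι fun s => count (atom B s.1) (Φ ω) :=
    funext fun ω => count_eq_sumAtoms (Φ ω)
  have hcC : (fun ω j => count (C j) (Φ ω))
      = fun ω => sumAtoms κ fun s => count (atom C s.1) (Φ ω) :=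
    funext fun ω => count_eq_sumAtoms (Φ ω)
  rw [hcB, hcC]
  exact hi.comp (φ := fun f => sumAtoms ι fun s => f ⟨Sum.inl s, by simp⟩)
    (ψ := fun f => sumAtoms κ fun s => f ⟨Sum.inr s, by simp⟩) .of_discrete .of_discrete

variable [BorelSpace X]

/-- The law of a Poisson process is determined by its intensity measure. -/
theorem map_eq [IsProbabilityMeasure P] {Ω' : Type*} [MeasurableSpace Ω'] {P' : Measure Ω'}
    [IsProbabilityMeasure P'] {Φ' : Ω' → LocFinSet X} (h : IsPoissonProcess P μ Φ)
    (h' : IsPoissonProcess P' μ Φ') (hμ : ∀ B, Bornology.IsBounded B → μ B ≠ ∞) :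
    P.map Φ = P'.map Φ' := by
  have hm := measurable_counts.comp h.measurable
  have hm' := measurable_counts.comp h'.measurable
  have hI : ∀ I : Finset (BoundedBorel X),
      (P'.map (counts ∘ Φ')).map I.restrict = (P.map (counts ∘ Φ)).map I.restrict := fun I => by
    rw [Measure.map_map (Finset.measurable_restrict I) hm,
      Measure.map_map (Finset.measurable_restrict I) hm']
    exact h'.map_counts_eq h (B := fun i : I => i.1.1) (fun i => i.1.2.1) (fun i => hμ _ i.1.2.2)
  have hP := Measure.isProbabilityMeasure_map (μ := P) hm.aemeasurable
  have : ∀ I : Finset (BoundedBorel X), IsFiniteMeasure ((P.map (counts ∘ Φ)).map I.restrict) :=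
    fun I => inferInstance
  -- A finite measure on a product is determined by its finite-dimensional marginals.
  have heq : P.map (counts ∘ Φ) = P'.map (counts ∘ Φ') :=
    IsProjectiveLimit.unique (P := fun I => (P.map (counts ∘ Φ)).map I.restrict)
      (fun I => rfl) hI
  ext A hA
  obtain ⟨A', hA', rfl⟩ := exists_counts_preimage hA
  rw [Measure.map_apply h.measurable hA, Measure.map_apply h'.measurable hA, ← preimage_comp,
    ← preimage_comp, ← Measure.map_apply hm hA', ← Measure.map_apply hm' hA', heq]

theorem map_isometryEquiv (h : IsPoissonProcess P μ Φ) (e : X ≃ᵢ X) (he : MeasurePreserving e μ μ) :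
    IsPoissonProcess P μ fun ω => (Φ ω).map e where
  measurable := (measurable_map e).comp h.measurable
  map_count B hB hμ := by
    simp only [count_map]
    have := he.measure_preimage hB.nullMeasurableSet
    rw [h.map_count _ (he.measurable hB) (by rwa [this]), this]
  iIndepFun_count n B hB hd := by
    simp only [count_map]
    exact h.iIndepFun_count n _ (fun i => he.measurable (hB i)) fun i j hij =>
      (hd hij).preimage e

theorem map_map_isometryEquiv [IsProbabilityMeasure P] (h : IsPoissonProcess P μ Φ)
    (hμ : ∀ B, Bornology.IsBounded B → μ B ≠ ∞) (e : X ≃ᵢ X) (he : MeasurePreserving e μ μ) :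
    P.map (fun ω => (Φ ω).map e) = P.map Φ :=
  (h.map_isometryEquiv e he).map_eq h hμ

/-- A configuration set that is invariant under a family of measure-preserving isometries which
move every bounded set off itself is trivial for the Poisson law. -/
theorem measure_eq_zero_or_one_of_invariant [IsProbabilityMeasure P]
    (h : IsPoissonProcess P μ Φ) (hμ : ∀ B, Bornology.IsBounded B → μ B ≠ ∞) {E : Set (X ≃ᵢ X)}
    (hE : ∀ e ∈ E, MeasurePreserving e μ μ)
    (hoff : ∀ K : Set X, Bornology.IsBounded K → ∃ e ∈ E, Disjoint K (e ⁻¹' K))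
    {A : Set (LocFinSet X)} (hA : MeasurableSet A)
    (hinv : ∀ e ∈ E, LocFinSet.map e ⁻¹' A =ᵐ[P.map Φ] A) :
    P.map Φ A = 0 ∨ P.map Φ A = 1 := by
  have hQ := Measure.isProbabilityMeasure_map (μ := P) h.measurable.aemeasurable
  set Q := P.map Φ with hQdef
  -- With `C` a cylinder event `ε`-close to `A` and `e` moving its window off itself, `Q (C ∩ e⁻¹ C)
  -- = Q C ^ 2`, while `Q (A ∩ e⁻¹ A) = Q A`. Replacing `C` by `A` costs `2ε` on each side.
  have key : ∀ ε : ℝ, 0 < ε → |Q.real A - Q.real A * Q.real A| ≤ 4 * ε := by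
    intro ε hε
    obtain ⟨A', hA', rfl⟩ := exists_counts_preimage hA
    obtain ⟨C', hC', hAC⟩ := (Measure.MeasureDense.of_generateFrom_isSetAlgebra_finite
      (Q.map counts) (isSetAlgebra_measurableCylinders (α := fun _ : BoundedBorel X => ℕ∞))
      generateFrom_measurableCylinders.symm).approx A' hA' (measure_ne_top _ _) ε hε
    obtain ⟨I, S, hS, rfl⟩ := (mem_measurableCylinders _).1 hC'
    have hCm : MeasurableSet (cylinder I S) :=
      MeasurableSet.cylinder (α := fun _ : BoundedBorel X => ℕ∞) I hS
    rw [Measure.map_apply measurable_counts (hA'.symmDiff hCm), preimage_symmDiff] at hAC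
    set A := counts ⁻¹' A'
    set C : Set (LocFinSet X) := counts ⁻¹' cylinder I S
    have hC : MeasurableSet C := measurable_counts hCm
    have hAC' : Q.real (symmDiff A C) ≤ ε :=
      ENNReal.toReal_le_of_le_ofReal hε.le hAC.le
    obtain ⟨e, heE, hdis⟩ := hoff (⋃ i ∈ I, i.1)
      ((Bornology.isBounded_biUnion I.finite_toSet).2 fun i _ => i.2.2)
    have hem := measurable_map e
    have hpres : MeasurePreserving (LocFinSet.map e) Q Q := by
      refine ⟨hem, ?_⟩
      rw [hQdef, Measure.map_map hem h.measurable]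
      exact h.map_map_isometryEquiv hμ e (hE e heE)
    have h1 : Q.real (C ∩ LocFinSet.map e ⁻¹' C) = Q.real C * Q.real C := by
      have hind := h.indepFun_counts (B := fun i : I => i.1.1) (C := fun i : I => e ⁻¹' i.1.1)
        (fun i => i.1.2.1) (fun i => e.continuous.measurable i.1.2.1) (fun i j =>
          hdis.mono (subset_biUnion_of_mem (u := fun i : BoundedBorel X => i.1) i.2)
            (preimage_mono (subset_biUnion_of_mem (u := fun i : BoundedBorel X => i.1) j.2)))
      have := hind.measure_inter_preimage_eq_mul S S hS hS
      have hC1 : (fun ω (i : I) => count i.1.1 (Φ ω)) ⁻¹' S = Φ ⁻¹' C := rfl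
      have hC2 : (fun ω (i : I) => count (e ⁻¹' i.1.1) (Φ ω)) ⁻¹' S
          = Φ ⁻¹' (LocFinSet.map e ⁻¹' C) := by
        simp only [← count_map]; rfl
      rw [hC1, hC2, ← preimage_inter, ← Measure.map_apply h.measurable (hC.inter (hem hC)),
        ← Measure.map_apply h.measurable hC, ← Measure.map_apply h.measurable (hem hC),
        ← hQdef, hpres.measure_preimage hC.nullMeasurableSet] at this
      rw [measureReal_def, this, ENNReal.toReal_mul, measureReal_def]
    have h2 : Q.real (A ∩ LocFinSet.map e ⁻¹' A) = Q.real A := by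
      refine measureReal_congr ?_
      filter_upwards [hinv e heE] with x hx
      have hx' : (x ∈ LocFinSet.map e ⁻¹' A) = (x ∈ A) := hx
      exact propext ⟨fun hx => hx.1, fun hxA => ⟨hxA, hx' ▸ hxA⟩⟩
    have h3 : |Q.real A - Q.real C| ≤ ε :=
      (abs_measureReal_sub_le_measureReal_symmDiff hA.nullMeasurableSet hC.nullMeasurableSet).trans
        hAC'
    have h4 : |Q.real (A ∩ LocFinSet.map e ⁻¹' A) - Q.real (C ∩ LocFinSet.map e ⁻¹' C)|
        ≤ 2 * ε := by
      refine (abs_measureReal_sub_le_measureReal_symmDiff (hA.inter (hem hA)).nullMeasurableSet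
        (hC.inter (hem hC)).nullMeasurableSet).trans ?_
      have hsub : symmDiff (A ∩ LocFinSet.map e ⁻¹' A) (C ∩ LocFinSet.map e ⁻¹' C)
          ⊆ symmDiff A C ∪ LocFinSet.map e ⁻¹' symmDiff A C := by
        intro x hx
        simp only [mem_symmDiff, mem_inter_iff, mem_preimage, mem_union] at hx ⊢
        tauto
      refine (measureReal_mono hsub).trans ((measureReal_union_le _ _).trans ?_)
      have h5 : Q.real (LocFinSet.map e ⁻¹' symmDiff A C) = Q.real (symmDiff A C) := by
        rw [measureReal_def, hpres.measure_preimage (hA.symmDiff hC).nullMeasurableSet,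
          measureReal_def]
      rw [h5]
      linarith
    rw [h1, h2] at h4
    have h5 : 0 ≤ Q.real A ∧ Q.real A ≤ 1 := ⟨measureReal_nonneg, measureReal_le_one⟩
    have h6 : 0 ≤ Q.real C ∧ Q.real C ≤ 1 := ⟨measureReal_nonneg, measureReal_le_one⟩
    have h7 : |Q.real C * Q.real C - Q.real A * Q.real A| ≤ 2 * ε := by
      have : Q.real C * Q.real C - Q.real A * Q.real A
          = -((Q.real A - Q.real C) * (Q.real A + Q.real C)) := by ring
      rw [this, abs_neg, abs_mul, mul_comm]
      refine mul_le_mul ?_ h3 (abs_nonneg _) (by norm_num)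
      rw [abs_of_nonneg (by linarith)]
      linarith
    calc _ = |(Q.real A - Q.real C * Q.real C) + (Q.real C * Q.real C - Q.real A * Q.real A)| := by
          congr 1; ring
      _ ≤ _ := abs_add_le _ _
      _ ≤ 4 * ε := by linarith
  have hzero : Q.real A - Q.real A * Q.real A = 0 := by
    by_contra hne
    have := key (|Q.real A - Q.real A * Q.real A| / 8) (by positivity)
    have hpos := abs_pos.2 hne
    linarith
  have : Q.real A = 0 ∨ Q.real A = 1 := by
    have : Q.real A * (1 - Q.real A) = 0 := by linarith
    rcases mul_eq_zero.1 this with h0 | h0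
    · exact Or.inl h0
    · exact Or.inr (by linarith)
  rcases this with h0 | h0
  · exact Or.inl ((measureReal_eq_zero_iff).1 h0)
  · right
    rw [measureReal_def] at h0
    rw [← ENNReal.ofReal_toReal (measure_ne_top Q A), h0, ENNReal.ofReal_one]

end IsPoissonProcess

/-! ### Factorial moment estimates for Poisson processes -/

theorem lintegral_natCast_poissonMeasure (r : ℝ≥0) :
    ∫⁻ n : ℕ, (n : ℝ≥0∞) ∂poissonMeasure r = r := by
  have hs : HasSum (fun n : ℕ => Real.exp (-r) * r ^ n / n.factorial * n) (r : ℝ) := by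
    rw [← hasSum_nat_add_iff' 1]
    simp only [Finset.range_one, Finset.sum_singleton, CharP.cast_eq_zero, mul_zero, sub_zero]
    have h1 := (hasSum_one_poissonMeasure r).mul_left (r : ℝ)
    rw [mul_one] at h1
    refine h1.congr_fun fun n => ?_
    rw [Nat.factorial_succ]
    push_cast
    field_simp
    exact pow_succ' _ _
  rw [poissonMeasure, lintegral_sum_measure]
  simp only [lintegral_smul_measure, lintegral_dirac, smul_eq_mul]
  have : ∀ n : ℕ, ENNReal.ofReal (Real.exp (-r) * r ^ n / n.factorial) * (n : ℝ≥0∞)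
      = ENNReal.ofReal (Real.exp (-r) * r ^ n / n.factorial * n) := fun n => by
    rw [ENNReal.ofReal_mul (by positivity), ENNReal.ofReal_natCast]
  simp only [this]
  rw [← ENNReal.ofReal_tsum_of_nonneg (fun n => by positivity) hs.summable, hs.tsum_eq,
    ENNReal.ofReal_coe_nnreal]

theorem LocFinSet.measurable_pi_restrict_measure {X ι : Type*} [MetricSpace X] [MeasurableSpace X]
    [BorelSpace X] [Fintype ι] {U : ι → Set X} (hU : ∀ i, MeasurableSet (U i))
    (hUb : ∀ i, Bornology.IsBounded (U i)) :
    Measurable fun S : LocFinSet X => Measure.pi fun i => S.measure.restrict (U i) := by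
  have hfin : ∀ (S : LocFinSet X) i, IsFiniteMeasure (S.measure.restrict (U i)) := fun S i => by
    refine ⟨?_⟩
    rw [Measure.restrict_apply_univ, measure_apply _ (hU i)]
    exact_mod_cast S.count_lt_top (hUb i)
  have hm : ∀ s : ι → Set X, (∀ i, MeasurableSet (s i)) → Measurable fun S : LocFinSet X =>
      (Measure.pi fun i => S.measure.restrict (U i)) (univ.pi s) := fun s hs => by
    simp only [Measure.pi_pi, Measure.restrict_apply (hs _)]
    exact Finset.measurable_prod _ fun i _ =>
      (kernel X).measurable_coe ((hs i).inter (hU i))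
  refine Measurable.measure_of_isPiSystem generateFrom_pi.symm isPiSystem_pi ?_ ?_
  · rintro _ ⟨s, hs, rfl⟩
    exact hm s fun i => hs i trivial
  · simpa using hm (fun _ => univ) fun _ => MeasurableSet.univ

namespace IsPoissonProcess

open LocFinSet

variable {Ω X : Type*} [MeasurableSpace Ω] [MetricSpace X] [MeasurableSpace X] [BorelSpace X]
  {P : Measure Ω} {μ : Measure X} {Φ : Ω → LocFinSet X}

theorem lintegral_measure (h : IsPoissonProcess P μ Φ) {B : Set X} (hB : MeasurableSet B)
    (hμ : μ B ≠ ∞) : ∫⁻ ω, (Φ ω).measure B ∂P = μ B := by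
  simp only [measure_apply _ hB]
  rw [← lintegral_map (f := fun n : ℕ∞ => (n : ℝ≥0∞)) .of_discrete (h.measurable_count hB),
    h.map_count B hB hμ, lintegral_map .of_discrete .of_discrete]
  simp only [ENat.toENNReal_coe, lintegral_natCast_poissonMeasure]
  exact ENNReal.coe_toNNReal hμ

theorem iIndepFun_measure (h : IsPoissonProcess P μ Φ) {ι : Type*} [Finite ι]
    {B : ι → Set X} (hB : ∀ i, MeasurableSet (B i))
    (hd : Pairwise fun i j => Disjoint (B i) (B j)) :
    iIndepFun (fun i ω => (Φ ω).measure (B i)) P := by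
  simp only [measure_apply _ (hB _)]
  exact (h.iIndepFun_count_of_finite hB hd).comp (fun _ (n : ℕ∞) => (n : ℝ≥0∞))
    fun _ => .of_discrete

/-- Over disjoint sides the counting measures are independent, so the mean of their product is the
product of the intensities (`hν`). A tuple of Poisson points in `A` gives `A` mass at least one, and
Markov's inequality concludes. -/
theorem measure_exists_mem_le_of_subset_pi (h : IsPoissonProcess P μ Φ) [SigmaFinite μ]
    (hμ : ∀ B, Bornology.IsBounded B → μ B ≠ ∞) {ι : Type*} [Fintype ι]
    {U : ι → Set X} (hU : ∀ i, MeasurableSet (U i)) (hUb : ∀ i, Bornology.IsBounded (U i))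
    (hd : Pairwise fun i j => Disjoint (U i) (U j)) {A : Set (ι → X)} (hA : MeasurableSet A)
    (hAU : A ⊆ univ.pi U) :
    P {ω | ∃ p ∈ A, ∀ i, p i ∈ (Φ ω).carrier} ≤ Measure.pi (fun _ => μ) A := by
  have hm : Measurable fun ω => Measure.pi fun i => (Φ ω).measure.restrict (U i) :=
    (measurable_pi_restrict_measure hU hUb).comp h.measurable
  have hfin : ∀ (S : LocFinSet X) i, IsFiniteMeasure (S.measure.restrict (U i)) := fun S i => by
    refine ⟨?_⟩
    rw [Measure.restrict_apply_univ, measure_apply _ (hU i)]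
    exact_mod_cast S.count_lt_top (hUb i)
  have hfin' : ∀ i, IsFiniteMeasure (μ.restrict (U i)) := fun i =>
    ⟨by rw [Measure.restrict_apply_univ]; exact (hμ _ (hUb i)).lt_top⟩
  have hν : Measure.pi (fun i => μ.restrict (U i))
      = P.bind fun ω => Measure.pi fun i => (Φ ω).measure.restrict (U i) := by
    refine Measure.pi_eq fun s hs => ?_
    rw [Measure.bind_apply (MeasurableSet.univ_pi hs) hm.aemeasurable]
    simp only [Measure.pi_pi, Measure.restrict_apply (hs _)]
    have hind := h.iIndepFun_measure (fun i => (hs i).inter (hU i)) fun i j hij =>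
      (hd hij).mono inter_subset_right inter_subset_right
    rw [lintegral_prod_eq_prod_lintegral_of_indepFun Finset.univ _ hind fun i =>
      ((kernel X).measurable_coe ((hs i).inter (hU i))).comp h.measurable]
    exact Finset.prod_congr rfl fun i _ => (h.lintegral_measure ((hs i).inter (hU i))
      (hμ _ ((hUb i).subset inter_subset_right)))
  calc P {ω | ∃ p ∈ A, ∀ i, p i ∈ (Φ ω).carrier}
      ≤ P {ω | 1 ≤ (Measure.pi fun i => (Φ ω).measure.restrict (U i)) A} := by
        refine measure_mono ?_
        rintro ω ⟨p, hp, hpΦ⟩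
        refine le_trans ?_ (measure_mono (singleton_subset_iff.2 hp))
        rw [Measure.pi_singleton]
        refine (Finset.prod_eq_one fun i _ => ?_).ge
        have : (Φ ω).carrier ∩ {p i} = {p i} :=
          inter_eq_right.2 (singleton_subset_iff.2 (hpΦ i))
        rw [Measure.restrict_apply (measurableSet_singleton _),
          inter_eq_left.2 (singleton_subset_iff.2 (hAU hp i trivial)),
          measure_apply _ (measurableSet_singleton _), count, this]
        simp
    _ ≤ ∫⁻ ω, (Measure.pi fun i => (Φ ω).measure.restrict (U i)) A ∂P := by
        simpa using mul_meas_ge_le_lintegral₀ (((Measure.measurable_coe hA).comp hm).aemeasurable) 1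
    _ = Measure.pi (fun i => μ.restrict (U i)) A := by
        rw [hν, Measure.bind_apply hA hm.aemeasurable]
    _ ≤ Measure.pi (fun _ => μ) A := by
        rw [← Measure.restrict_pi_pi]
        exact Measure.restrict_apply_le _ _

/-- The probability that a measurable set of tuples contains a tuple of distinct points of a
Poisson process is at most its product measure. -/
theorem measure_exists_injective_le [SecondCountableTopology X] (h : IsPoissonProcess P μ Φ)
    [SigmaFinite μ] (hμ : ∀ B, Bornology.IsBounded B → μ B ≠ ∞) {ι : Type*} [Fintype ι]
    {A : Set (ι → X)} (hA : MeasurableSet A) :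
    P {ω | ∃ p ∈ A, Function.Injective p ∧ ∀ i, p i ∈ (Φ ω).carrier}
      ≤ Measure.pi (fun _ => μ) A := by
  -- Countably many boxes with bounded, pairwise disjoint sides cover all injective tuples. Making
  -- the boxes disjoint lets the bounds add up to the measure of at most `A`.
  let J := {U : ι → TopologicalSpace.countableBasis X //
    (∀ i, Bornology.IsBounded (U i).1) ∧ Pairwise fun i j => Disjoint (U i).1 (U j).1}
  have hcover : ∀ p : ι → X, Function.Injective p → ∃ U : J, ∀ i, p i ∈ (U.1 i).1 := by
    intro p hp
    obtain ⟨V, hV, hVd⟩ := (finite_range p).t2_separation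
    have hex : ∀ i, ∃ U ∈ TopologicalSpace.countableBasis X, p i ∈ U ∧
        U ⊆ V (p i) ∩ Metric.ball (p i) 1 := fun i =>
      (TopologicalSpace.isBasis_countableBasis X).exists_subset_of_mem_open
        ⟨(hV _).1, Metric.mem_ball_self one_pos⟩ ((hV _).2.inter Metric.isOpen_ball)
    choose U hU hpU hUV using hex
    refine ⟨⟨fun i => ⟨U i, hU i⟩, fun i => Metric.isBounded_ball.subset
      ((hUV i).trans inter_subset_right), fun i j hij => ?_⟩, hpU⟩
    exact (hVd ⟨i, rfl⟩ ⟨j, rfl⟩ (hp.ne hij)).mono ((hUV i).trans inter_subset_left)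
      ((hUV j).trans inter_subset_left)
  rcases isEmpty_or_nonempty J with hJ | hJ
  · have : {ω | ∃ p ∈ A, Function.Injective p ∧ ∀ i, p i ∈ (Φ ω).carrier} = ∅ := by
      ext ω
      simp only [mem_ofPred_eq, mem_empty_iff_false, iff_false]
      rintro ⟨p, -, hp, -⟩
      exact hJ.elim (hcover p hp).choose
    rw [this, measure_empty]
    exact zero_le
  · obtain ⟨f, hf⟩ := exists_surjective_nat J
    let box : ℕ → Set (ι → X) := fun n => univ.pi fun i => ((f n).1 i).1
    have hUm : ∀ n i, MeasurableSet ((f n).1 i).1 := fun n i =>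
      (TopologicalSpace.isOpen_of_mem_countableBasis ((f n).1 i).2).measurableSet
    have hbox : ∀ n, MeasurableSet (disjointed box n) := fun n =>
      MeasurableSet.disjointed (fun n => MeasurableSet.univ_pi fun i => hUm n i) n
    calc P {ω | ∃ p ∈ A, Function.Injective p ∧ ∀ i, p i ∈ (Φ ω).carrier}
        ≤ P (⋃ n, {ω | ∃ p ∈ A ∩ disjointed box n, ∀ i, p i ∈ (Φ ω).carrier}) := by
          refine measure_mono ?_
          rintro ω ⟨p, hpA, hp, hpΦ⟩
          obtain ⟨U, hU⟩ := hcover p hp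
          obtain ⟨n, rfl⟩ := hf U
          have : p ∈ ⋃ n, disjointed box n := by
            rw [iUnion_disjointed]
            exact mem_iUnion.2 ⟨n, fun i _ => hU i⟩
          obtain ⟨m, hm⟩ := mem_iUnion.1 this
          exact mem_iUnion.2 ⟨m, p, ⟨hpA, hm⟩, hpΦ⟩
      _ ≤ ∑' n, P {ω | ∃ p ∈ A ∩ disjointed box n, ∀ i, p i ∈ (Φ ω).carrier} :=
          measure_iUnion_le _
      _ ≤ ∑' n, Measure.pi (fun _ => μ) (A ∩ disjointed box n) :=
          ENNReal.tsum_le_tsum fun n => h.measure_exists_mem_le_of_subset_pi hμ (hUm n)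
            (f n).2.1 (f n).2.2 (hA.inter (hbox n))
            (inter_subset_right.trans (disjointed_subset _ _))
      _ = Measure.pi (fun _ => μ) (⋃ n, A ∩ disjointed box n) :=
          (measure_iUnion (fun m n hmn => (disjoint_disjointed box hmn).mono inter_subset_right
            inter_subset_right) fun n => hA.inter (hbox n)).symm
      _ ≤ Measure.pi (fun _ => μ) A := measure_mono (iUnion_subset fun n => inter_subset_left)

/-- Almost surely, no tuple of distinct points of a Poisson process lies in a given null set. -/
theorem ae_forall_injective_notMem [SecondCountableTopology X] (h : IsPoissonProcess P μ Φ)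
    [SigmaFinite μ] (hμ : ∀ B, Bornology.IsBounded B → μ B ≠ ∞) {ι : Type*} [Fintype ι]
    {A : Set (ι → X)} (hA : Measure.pi (fun _ => μ) A = 0) :
    ∀ᵐ ω ∂P, ∀ p : ι → X, Function.Injective p → (∀ i, p i ∈ (Φ ω).carrier) → p ∉ A := by
  have hle := h.measure_exists_injective_le hμ
    (measurableSet_toMeasurable (Measure.pi fun _ : ι => μ) A)
  rw [measure_toMeasurable, hA] at hle
  have hae := measure_eq_zero_iff_ae_notMem.1 (le_antisymm hle zero_le)
  filter_upwards [hae] with ω hω p hp hpΦ hpA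
  exact hω ⟨p, subset_toMeasurable _ _ hpA, hp, hpΦ⟩

end IsPoissonProcess

/-! ### Space-time and the symmetries of the graphical construction -/

/-- Lebesgue measure on `[0, ∞)`. -/
noncomputable def timeVolume : Measure ℝ≥0 :=
  Measure.comap (fun t : ℝ≥0 => (t : ℝ)) (volume : Measure ℝ)

theorem spaceTimeVolume_eq_prod (d : ℕ) :
    spaceTimeVolume d = (volume : Measure (Space d)).prod timeVolume := rfl

theorem measurableEmbedding_nnrealCoe : MeasurableEmbedding (fun t : ℝ≥0 => (t : ℝ)) :=
  MeasurableEmbedding.subtype_coe measurableSet_Ici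

theorem timeVolume_apply (s : Set ℝ≥0) : timeVolume s = volume ((fun t : ℝ≥0 => (t : ℝ)) '' s) :=
  measurableEmbedding_nnrealCoe.comap_apply _ _

theorem timeVolume_singleton (t : ℝ≥0) : timeVolume {t} = 0 := by
  rw [timeVolume_apply, image_singleton, Real.volume_singleton]

theorem timeVolume_Iic (t : ℝ≥0) : timeVolume (Iic t) = t := by
  have : (fun t : ℝ≥0 => (t : ℝ)) '' Iic t = Icc 0 (t : ℝ) := by
    ext x
    constructor
    · rintro ⟨s, hs, rfl⟩
      exact ⟨s.2, hs⟩
    · intro hx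
      exact ⟨⟨x, hx.1⟩, hx.2, rfl⟩
  rw [timeVolume_apply, this, Real.volume_Icc, sub_zero, ENNReal.ofReal_coe_nnreal]

theorem timeVolume_ne_top {B : Set ℝ≥0} (hB : Bornology.IsBounded B) : timeVolume B ≠ ∞ := by
  rw [timeVolume_apply]
  exact (isometry_subtype_coe.lipschitz.isBounded_image hB).measure_lt_top.ne

instance : IsLocallyFiniteMeasure timeVolume :=
  ⟨fun t => ⟨Metric.ball t 1, Metric.ball_mem_nhds t one_pos,
    (timeVolume_ne_top Metric.isBounded_ball).lt_top⟩⟩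

instance (d : ℕ) : SigmaFinite (spaceTimeVolume d) := by
  rw [spaceTimeVolume_eq_prod]; infer_instance

theorem spaceTimeVolume_ne_top {d : ℕ} (B : Set (SpaceTime d)) (hB : Bornology.IsBounded B) :
    spaceTimeVolume d B ≠ ∞ := by
  have hsub : B ⊆ (Prod.fst '' B) ×ˢ (Prod.snd '' B) := fun p hp =>
    ⟨mem_image_of_mem _ hp, mem_image_of_mem _ hp⟩
  refine ne_top_of_le_ne_top ?_ (measure_mono hsub)
  rw [spaceTimeVolume_eq_prod, Measure.prod_prod]
  exact ENNReal.mul_ne_top hB.image_fst.measure_lt_top.ne (timeVolume_ne_top hB.image_snd)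

/-- The action on space-time of an isometry of space. -/
noncomputable def spaceIsometry {d : ℕ} (e : Space d ≃ᵢ Space d) : SpaceTime d ≃ᵢ SpaceTime d where
  toEquiv := e.toEquiv.prodCongr (Equiv.refl _)
  isometry_toFun := e.isometry.prodMap isometry_id

theorem spaceIsometry_apply {d : ℕ} (e : Space d ≃ᵢ Space d) (p : SpaceTime d) :
    spaceIsometry e p = (e p.1, p.2) := rfl

theorem measurePreserving_spaceIsometry {d : ℕ} {e : Space d ≃ᵢ Space d}
    (he : MeasurePreserving e volume volume) :
    MeasurePreserving (spaceIsometry e) (spaceTimeVolume d) (spaceTimeVolume d) := by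
  rw [spaceTimeVolume_eq_prod]
  exact he.prod (MeasurePreserving.id timeVolume)

namespace Parking

variable {d : ℕ} {ρ : ℝ} {V : Set (SpaceTime d)} {f : SpaceTime d → SpaceTime d}

theorem lexLT_irrefl (x : Space d) : ¬ LexLT x x := fun ⟨_, _, h⟩ => lt_irrefl _ h

theorem roots_image {W : Set (SpaceTime d)} (hWV : W ⊆ V)
    (hf : ∀ p ∈ V, ∀ q ∈ V, (Edge ρ (f p) (f q) ↔ Edge ρ p q)) :
    roots ρ (f '' W) = f '' roots ρ W := by
  ext p
  constructor
  · rintro ⟨⟨p, hp, rfl⟩, hr⟩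
    exact ⟨p, ⟨hp, fun q hq he => hr (f q) (mem_image_of_mem f hq)
      ((hf q (hWV hq) p (hWV hp)).2 he)⟩, rfl⟩
  · rintro ⟨p, ⟨hp, hr⟩, rfl⟩
    refine ⟨mem_image_of_mem f hp, ?_⟩
    rintro _ ⟨q, hq, rfl⟩ he
    exact hr q hq ((hf q (hWV hq) p (hWV hp)).1 he)

theorem offspring_image {W : Set (SpaceTime d)} (hWV : W ⊆ V)
    (hf : ∀ p ∈ V, ∀ q ∈ V, (Edge ρ (f p) (f q) ↔ Edge ρ p q)) :
    offspring ρ (f '' W) = f '' offspring ρ W := by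
  ext p
  rw [offspring, roots_image hWV hf]
  constructor
  · rintro ⟨⟨p, hp, rfl⟩, _, ⟨q, hq, rfl⟩, he⟩
    exact ⟨p, ⟨hp, q, hq, (hf q (hWV hq.1) p (hWV hp)).1 he⟩, rfl⟩
  · rintro ⟨p, ⟨hp, q, hq, he⟩, rfl⟩
    exact ⟨mem_image_of_mem f hp, f q, mem_image_of_mem f hq,
      (hf q (hWV hq.1) p (hWV hp)).2 he⟩

theorem remaining_subset (ρ : ℝ) (V : Set (SpaceTime d)) (n : ℕ) : remaining ρ V n ⊆ V :=
  remaining_antitone ρ V (Nat.zero_le n)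

theorem remaining_image (hinj : Function.Injective f)
    (hf : ∀ p ∈ V, ∀ q ∈ V, (Edge ρ (f p) (f q) ↔ Edge ρ p q)) (n : ℕ) :
    remaining ρ (f '' V) n = f '' remaining ρ V n := by
  induction n with
  | zero => rfl
  | succ n ih =>
    have h := remaining_subset ρ V n
    rw [remaining, ih, roots_image h hf, offspring_image h hf, ← image_union,
      ← image_sdiff hinj, remaining]

/-- The construction depends only on the graph, so it commutes with graph isomorphisms. The edge
condition is asked on `V` only, since a rotation need not respect the lexicographic order at tied
times. -/
theorem accepted_image (hinj : Function.Injective f)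
    (hf : ∀ p ∈ V, ∀ q ∈ V, (Edge ρ (f p) (f q) ↔ Edge ρ p q)) :
    accepted ρ (f '' V) = f '' accepted ρ V := by
  simp only [accepted, image_iUnion]
  refine iUnion_congr fun n => ?_
  rw [remaining_image hinj hf, roots_image (remaining_subset ρ V n) hf]

theorem parkingSet_map (hρ : 0 < ρ) (e : Space d ≃ᵢ Space d) (V : LocFinSet (SpaceTime d))
    (hf : ∀ p ∈ V.carrier, ∀ q ∈ V.carrier,
      (Edge ρ (spaceIsometry e p) (spaceIsometry e q) ↔ Edge ρ p q)) :
    parkingSet hρ (V.map (spaceIsometry e)) = (parkingSet hρ V).map e := by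
  ext1
  change Prod.fst '' accepted ρ (spaceIsometry e '' V.carrier)
    = e '' (Prod.fst '' accepted ρ V.carrier)
  rw [accepted_image (spaceIsometry e).injective hf, image_image, image_image]
  rfl

theorem edge_translate (x : Space d) (p q : SpaceTime d) :
    Edge ρ (spaceIsometry (IsometryEquiv.addLeft x) p) (spaceIsometry (IsometryEquiv.addLeft x) q)
      ↔ Edge ρ p q := by
  simp [edge_iff, spaceIsometry_apply, LexLT]

theorem parkingSet_translate (hρ : 0 < ρ) (x : Space d) (V : LocFinSet (SpaceTime d)) :
    parkingSet hρ (V.map (spaceIsometry (IsometryEquiv.addLeft x))) = x +ᵥ parkingSet hρ V :=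
  parkingSet_map hρ _ V fun p _ q _ => edge_translate x p q

theorem edge_spaceIsometry (e : Space d ≃ᵢ Space d)
    (hV : ∀ p ∈ V, ∀ q ∈ V, p.2 = q.2 → p = q) :
    ∀ p ∈ V, ∀ q ∈ V, (Edge ρ (spaceIsometry e p) (spaceIsometry e q) ↔ Edge ρ p q) := by
  intro p hp q hq
  simp only [edge_iff, spaceIsometry_apply, e.dist_eq]
  refine and_congr_right fun _ => or_congr_right (and_congr_right fun h => ?_)
  obtain rfl := hV p hp q hq h
  exact iff_of_false (lexLT_irrefl _) (lexLT_irrefl _)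

/-! ### Stationarity, isotropy and ergodicity of the parking set -/

variable {Ω : Type*} [MeasurableSpace Ω] {P : Measure Ω} {Φ : Ω → LocFinSet (SpaceTime d)}

theorem ae_injOn_time (hΦ : IsPoissonProcess P (spaceTimeVolume d) Φ) :
    ∀ᵐ ω ∂P, ∀ p ∈ (Φ ω).carrier, ∀ q ∈ (Φ ω).carrier, p.2 = q.2 → p = q := by
  have hnull : Measure.pi (fun _ : Fin 2 => spaceTimeVolume d) {p | (p 0).2 = (p 1).2} = 0 := by
    have hm : MeasurableSet {p : SpaceTime d × SpaceTime d | p.1.2 = p.2.2} :=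
      measurableSet_eq_fun measurable_fst.snd measurable_snd.snd
    have := (measurePreserving_finTwoArrow (spaceTimeVolume d)).measure_preimage
      hm.nullMeasurableSet
    refine this.trans ?_
    rw [Measure.measure_prod_null hm]
    refine Filter.Eventually.of_forall fun p => ?_
    have hs : Prod.mk p ⁻¹' {p : SpaceTime d × SpaceTime d | p.1.2 = p.2.2}
        = univ ×ˢ {p.2} := by
      ext q; simp [eq_comm]
    change spaceTimeVolume d (Prod.mk p ⁻¹' {p | p.1.2 = p.2.2}) = 0
    rw [hs, spaceTimeVolume_eq_prod, Measure.prod_prod, timeVolume_singleton, mul_zero]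
  filter_upwards [hΦ.ae_forall_injective_notMem spaceTimeVolume_ne_top hnull] with ω hω p hp q hq h
  by_contra hne
  refine hω ![p, q] ?_ ?_ (by simpa using h)
  · intro i j hij
    fin_cases i <;> fin_cases j <;> simp_all
  · intro i
    fin_cases i <;> assumption

variable [IsProbabilityMeasure P]

theorem map_parkingSet_spaceIsometry (hΦ : IsPoissonProcess P (spaceTimeVolume d) Φ) (hρ : 0 < ρ)
    {e : Space d ≃ᵢ Space d} (he : MeasurePreserving e volume volume) :
    P.map (fun ω => parkingSet hρ ((Φ ω).map (spaceIsometry e)))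
      = P.map fun ω => parkingSet hρ (Φ ω) := by
  have hm := measurable_parkingSet (d := d) hρ
  have h := congrArg (Measure.map (parkingSet hρ)) (hΦ.map_map_isometryEquiv
    spaceTimeVolume_ne_top _ (measurePreserving_spaceIsometry he))
  rwa [Measure.map_map hm (hΦ.map_isometryEquiv _ (measurePreserving_spaceIsometry he)).measurable,
    Measure.map_map hm hΦ.measurable] at h

theorem isStationary_parkingSet (hΦ : IsPoissonProcess P (spaceTimeVolume d) Φ) (hρ : 0 < ρ) :
    PointProcess.IsStationary P fun ω => parkingSet hρ (Φ ω) := by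
  intro x
  simp only [← parkingSet_translate]
  exact map_parkingSet_spaceIsometry hΦ hρ (measurePreserving_add_left volume x)

theorem isIsotropic_parkingSet (hΦ : IsPoissonProcess P (spaceTimeVolume d) Φ) (hρ : 0 < ρ) :
    PointProcess.IsIsotropic P fun ω => parkingSet hρ (Φ ω) := by
  intro R _
  have hae : (fun ω => (parkingSet hρ (Φ ω)).map R.toIsometryEquiv)
      =ᵐ[P] fun ω => parkingSet hρ ((Φ ω).map (spaceIsometry R.toIsometryEquiv)) := by
    filter_upwards [ae_injOn_time hΦ] with ω hω
    exact (parkingSet_map hρ _ _ (edge_spaceIsometry _ hω)).symm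
  rw [Measure.map_congr hae]
  exact map_parkingSet_spaceIsometry hΦ hρ R.measurePreserving

theorem exists_translate_disjoint (hd : 1 ≤ d) (K : Set (SpaceTime d))
    (hK : Bornology.IsBounded K) :
    ∃ x : Space d, Disjoint K (spaceIsometry (IsometryEquiv.addLeft x) ⁻¹' K) := by
  obtain ⟨D, hD⟩ := Metric.isBounded_iff.1 hK
  -- The shift is longer than the bound `D` on distances within `K`.
  refine ⟨EuclideanSpace.single ⟨0, hd⟩ (|D| + 1), Set.disjoint_left.2 fun p hp hp' => ?_⟩
  have h1 := hD hp' hp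
  rw [Prod.dist_eq] at h1
  have h2 := (le_max_left _ _).trans h1
  rw [spaceIsometry_apply, IsometryEquiv.addLeft_apply, dist_eq_norm, add_sub_cancel_right,
    PiLp.norm_single, Real.norm_eq_abs, abs_of_pos (by positivity)] at h2
  linarith [le_abs_self D]

/-- The law is a factor of the Poisson law: by equivariance, an almost invariant set of parking
configurations pulls back to an almost invariant set of Poisson configurations. -/
theorem ergodicVAdd_parkingSet (hΦ : IsPoissonProcess P (spaceTimeVolume d) Φ) (hρ : 0 < ρ)
    (hd : 1 ≤ d) :
    ErgodicVAdd (Space d) (LocFinSet (Space d)) (P.map fun ω => parkingSet hρ (Φ ω)) := by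
  have hm := measurable_parkingSet (d := d) hρ
  have hξ : Measurable fun ω => parkingSet hρ (Φ ω) := hm.comp hΦ.measurable
  have hvadd : ∀ x : Space d, Measurable fun S : LocFinSet (Space d) => x +ᵥ S := fun x =>
    LocFinSet.measurable_map _
  have hQ := Measure.isProbabilityMeasure_map (μ := P) hξ.aemeasurable
  have hmap : P.map (fun ω => parkingSet hρ (Φ ω)) = (P.map Φ).map (parkingSet hρ) :=
    (Measure.map_map hm hΦ.measurable).symm
  refine { measure_preimage_vadd := fun x s hs => ?_,
           aeconst_of_forall_preimage_vadd_ae_eq := fun {s} hs hinv => ?_ }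
  · rw [← Measure.map_apply (hvadd x) hs, Measure.map_map (hvadd x) hξ]
    exact congrArg (fun μ : Measure (LocFinSet (Space d)) => μ s)
      (isStationary_parkingSet hΦ hρ x)
  · have h01 := hΦ.measure_eq_zero_or_one_of_invariant spaceTimeVolume_ne_top
      (E := range fun x : Space d => spaceIsometry (IsometryEquiv.addLeft x))
      (by
        rintro _ ⟨x, rfl⟩
        exact measurePreserving_spaceIsometry (measurePreserving_add_left volume x))
      (fun K hK => by
        obtain ⟨x, hx⟩ := exists_translate_disjoint hd K hK
        exact ⟨_, ⟨x, rfl⟩, hx⟩)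
      (hm hs)
      (by
        rintro _ ⟨x, rfl⟩
        have h1 := hinv x
        rw [hmap] at h1
        have h2 := (hm.quasiMeasurePreserving (P.map Φ)).preimage_ae_eq h1
        have h3 : LocFinSet.map (spaceIsometry (IsometryEquiv.addLeft x)) ⁻¹'
            (parkingSet hρ ⁻¹' s) = parkingSet hρ ⁻¹' ((fun S => x +ᵥ S) ⁻¹' s) := by
          ext V
          simp only [mem_preimage, parkingSet_translate]
        change LocFinSet.map (spaceIsometry (IsometryEquiv.addLeft x)) ⁻¹' _ =ᵐ[P.map Φ] _
        rwa [h3])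
    rw [← Measure.map_apply hm hs, ← hmap] at h01
    rw [Filter.eventuallyConst_set']
    rcases h01 with h | h
    · exact Or.inl (ae_eq_empty.2 h)
    · exact Or.inr (Filter.eventuallyEq_univ.2 ((mem_ae_iff_prob_eq_one hs).2 h))

end Parking

/-! ### General position -/

theorem pi_spaceTimeVolume_eq_zero {d : ℕ} {ι : Type*} [Fintype ι] {N : Set (ι → Space d)}
    (hN : Measure.pi (fun _ : ι => (volume : Measure (Space d))) N = 0) :
    Measure.pi (fun _ : ι => spaceTimeVolume d) {p | (fun i => (p i).1) ∈ N} = 0 := by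
  have h := measurePreserving_arrowProdEquivProdArrow (Space d) ℝ≥0 ι
    (fun _ => volume) (fun _ => timeVolume)
  have hN' : ((Measure.pi fun _ : ι => (volume : Measure (Space d))).prod
      (Measure.pi fun _ : ι => timeVolume)) (N ×ˢ univ) = 0 := by
    rw [Measure.prod_prod, hN, zero_mul]
  refine measure_mono_null ?_ (h.quasiMeasurePreserving.preimage_null hN')
  intro p hp
  exact ⟨hp, trivial⟩

/-- Distinct parking points lift to distinct Poisson points, so the first-moment bound transfers
although the parking process itself is not Poisson. -/
theorem Parking.ae_forall_parkingSet_notMem {d : ℕ} {ρ : ℝ} {Ω : Type*} [MeasurableSpace Ω]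
    {P : Measure Ω} {Φ : Ω → LocFinSet (SpaceTime d)}
    (hΦ : IsPoissonProcess P (spaceTimeVolume d) Φ) (hρ : 0 < ρ) {ι : Type*} [Fintype ι]
    {N : Set (ι → Space d)} (hN : Measure.pi (fun _ : ι => (volume : Measure (Space d))) N = 0) :
    ∀ᵐ ω ∂P, ∀ x : ι → Space d, Function.Injective x →
      (∀ i, x i ∈ (parkingSet hρ (Φ ω)).carrier) → x ∉ N := by
  filter_upwards [hΦ.ae_forall_injective_notMem spaceTimeVolume_ne_top
    (pi_spaceTimeVolume_eq_zero hN)] with ω hω x hx hxξ hxN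
  choose p hp hpx using hxξ
  have hpx' : (fun i => (p i).1) = x := funext hpx
  refine hω p (fun i j hij => hx ?_) (fun i => accepted_subset _ _ (hp i)) ?_
  · rw [← hpx i, ← hpx j, hij]
  · rwa [← hpx'] at hxN

/-- The tuples whose images under `φ` are linearly dependent form a null set, if the preimage of
every hyperplane under `φ` is a null set. -/
theorem pi_volume_not_linearIndependent {Y E : Type*} [MeasureSpace Y] [TopologicalSpace Y]
    [BorelSpace Y] [SecondCountableTopology Y] [SigmaFinite (volume : Measure Y)]
    [NormedAddCommGroup E] [NormedSpace ℝ E] [FiniteDimensional ℝ E]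
    {φ : Y → E} (hφ : Continuous φ)
    (hnull : ∀ l : E →ₗ[ℝ] ℝ, l ≠ 0 → volume {y | l (φ y) = 0} = 0) (n : ℕ)
    (hn : n ≤ Module.finrank ℝ E) :
    Measure.pi (fun _ : Fin n => (volume : Measure Y)) {x | ¬ LinearIndependent ℝ (φ ∘ x)} = 0 := by
  induction n with
  | zero => simp
  | succ n ih =>
    have hmeas : ∀ m : ℕ, MeasurableSet {x : Fin m → Y | ¬ LinearIndependent ℝ (φ ∘ x)} := fun m =>
      ((isOpen_setOfPred_linearIndependent (𝕜 := ℝ) (E := E) (ι := Fin m)).preimage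
        (f := fun x : Fin m → Y => φ ∘ x) (by fun_prop)).isClosed_compl.measurableSet
    have hp := measurePreserving_piFinSuccAbove (fun _ : Fin (n + 1) => (volume : Measure Y)) 0
    rw [← (hp.symm).measure_preimage (hmeas _).nullMeasurableSet,
      Measure.prod_apply_symm (hp.symm.measurable (hmeas _)), lintegral_eq_zero_iff
      (measurable_measure_prodMk_right (hp.symm.measurable (hmeas _)))]
    have hae := measure_eq_zero_iff_ae_notMem.1 (ih (by omega))
    filter_upwards [hae] with x hx
    have hx' : LinearIndependent ℝ (φ ∘ x) := by simpa using hx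
    -- The `n` given vectors are too few to span, so some hyperplane contains them; dependence
    -- forces the new vector into it.
    have hlt : Submodule.span ℝ (range (φ ∘ x)) < ⊤ := by
      refine Submodule.lt_top_of_finrank_lt_finrank ((finrank_range_le_card (φ ∘ x)).trans_lt ?_)
      rw [Fintype.card_fin]
      omega
    obtain ⟨l, hl, hle⟩ := Submodule.exists_le_ker_of_lt_top _ hlt
    refine measure_mono_null (fun y hy => ?_) (hnull l hl)
    refine hle ?_
    by_contra hy'
    refine hy ?_
    rw [linearIndependent_finSucc]
    exact ⟨hx', hy'⟩

theorem volume_quadric_eq_zero {d : ℕ} (hd : 1 ≤ d) (a b : ℝ) (v : Space d)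
    (h : ¬ (a = 0 ∧ v = 0 ∧ b = 0)) :
    volume {x : Space d | a + inner ℝ v x + b * ‖x‖ ^ 2 = 0} = 0 := by
  have : Nonempty (Fin d) := ⟨⟨0, hd⟩⟩
  by_cases hb : b = 0
  · by_cases hv : v = 0
    · have ha : a ≠ 0 := fun ha => h ⟨ha, hv, hb⟩
      simp [hb, hv, ha]
    · rcases Set.eq_empty_or_nonempty {x : Space d | a + inner ℝ v x + b * ‖x‖ ^ 2 = 0}
        with hE | ⟨x₀, hx₀⟩
      · rw [hE, measure_empty]
      · let s : AffineSubspace ℝ (Space d) := AffineSubspace.mk' x₀ (LinearMap.ker (innerₛₗ ℝ v))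
        have hs : s ≠ ⊤ := fun hs => by
          have h1 := AffineSubspace.direction_mk' x₀ (LinearMap.ker (innerₛₗ ℝ v))
          change s.direction = _ at h1
          rw [hs, AffineSubspace.direction_top] at h1
          have h2 : v ∈ LinearMap.ker (innerₛₗ ℝ v) := h1 ▸ Submodule.mem_top
          rw [LinearMap.mem_ker, innerₛₗ_apply_apply, inner_self_eq_zero] at h2
          exact hv h2
        refine measure_mono_null (fun x hx => ?_) (Measure.addHaar_affineSubspace volume s hs)
        change x ∈ s
        rw [AffineSubspace.mem_mk', vsub_eq_sub, LinearMap.mem_ker, innerₛₗ_apply_apply,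
          inner_sub_right]
        simp only [hb, zero_mul, add_zero, mem_ofPred_eq] at hx hx₀
        linarith
  -- Completing the square turns the quadric into part of a sphere with centre `-v / (2b)`. If the
  -- expression under the root is negative, the quadric is empty.
  · refine measure_mono_null (fun x hx => ?_) (Measure.addHaar_sphere volume (-(1 / (2 * b)) • v)
      (Real.sqrt (‖(-(1 / (2 * b))) • v‖ ^ 2 - a / b)))
    have hx' : a + inner ℝ v x + b * ‖x‖ ^ 2 = 0 := hx
    rw [mem_sphere_iff_norm, ← Real.sqrt_sq (norm_nonneg (x - _))]
    congr 1
    rw [norm_sub_sq_real, inner_smul_right, real_inner_comm]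
    have hx2 : ‖x‖ ^ 2 = -(a + inner ℝ v x) / b := by
      field_simp
      linarith
    rw [hx2]
    field_simp
    ring

theorem LinearIndependent.eq_zero_of_apply_eq_zero {E : Type*} [AddCommGroup E] [Module ℝ E]
    [FiniteDimensional ℝ E]
    {n : ℕ} {v : Fin n → E} (hv : LinearIndependent ℝ v) (hn : n = Module.finrank ℝ E)
    {l : E →ₗ[ℝ] ℝ} (hl : ∀ i, l (v i) = 0) : l = 0 := by
  have hspan := hv.span_eq_top_of_card_eq_finrank' (by simpa using hn)
  refine LinearMap.ext_on_range hspan fun i => ?_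
  simp [hl]

/-- Lifting `x` to `(1, x)` or `(1, x, ‖x‖ ^ 2)` turns lying on a common hyperplane or sphere into
lying in the kernel of a nonzero functional. Generic lifted tuples are bases, which rules this out.
-/
theorem Parking.ae_isGeneral_parkingSet {d : ℕ} (hd : 1 ≤ d) {ρ : ℝ} {Ω : Type*}
    [MeasurableSpace Ω] {P : Measure Ω} {Φ : Ω → LocFinSet (SpaceTime d)}
    (hΦ : IsPoissonProcess P (spaceTimeVolume d) Φ) (hρ : 0 < ρ) :
    ∀ᵐ ω ∂P, IsGeneral (parkingSet hρ (Φ ω)).carrier := by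
  have hE₁ : Module.finrank ℝ (ℝ × Space d) = d + 1 := by simp [add_comm]
  have hE₂ : Module.finrank ℝ (ℝ × Space d × ℝ) = d + 2 := by simp; omega
  have h₁ := pi_volume_not_linearIndependent (Y := Space d) (φ := fun x : Space d => ((1 : ℝ), x))
    (by fun_prop) (fun l hl => by
      let v := (InnerProductSpace.toDual ℝ (Space d)).symm
        (l.comp (LinearMap.inr ℝ ℝ (Space d))).toContinuousLinearMap
      have hv : ∀ x, inner ℝ v x = l (0, x) := fun x => by simp [v]
      have hlx : ∀ (t : ℝ) x, l (t, x) = t * l (1, 0) + inner ℝ v x := fun t x => by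
        rw [hv, ← smul_eq_mul, ← map_smul, ← map_add]; simp
      have h := volume_quadric_eq_zero hd (l (1, 0)) 0 v (fun ⟨h0, h1, _⟩ => hl <| by
        apply LinearMap.ext
        rintro ⟨t, x⟩
        rw [hlx, h0, h1]
        simp)
      convert h using 2
      ext x
      simp only [mem_ofPred_eq]
      rw [hlx, one_mul, zero_mul, add_zero]) (d + 1) hE₁.ge
  have h₂ := pi_volume_not_linearIndependent (Y := Space d)
    (φ := fun x : Space d => ((1 : ℝ), x, ‖x‖ ^ 2))
    (by fun_prop) (fun l hl => by
      let v := (InnerProductSpace.toDual ℝ (Space d)).symm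
        (l.comp ((LinearMap.inr ℝ ℝ (Space d × ℝ)).comp
          (LinearMap.inl ℝ (Space d) ℝ))).toContinuousLinearMap
      have hv : ∀ x, inner ℝ v x = l (0, x, 0) := fun x => by simp [v]
      have hlx : ∀ (t : ℝ) x s, l (t, x, s) = t * l (1, 0, 0) + inner ℝ v x + s * l (0, 0, 1) :=
        fun t x s => by
          rw [hv, ← smul_eq_mul, ← map_smul, ← map_add, ← smul_eq_mul, ← map_smul, ← map_add]
          simp
      have h := volume_quadric_eq_zero hd (l (1, 0, 0)) (l (0, 0, 1)) v (fun ⟨h0, h1, h2⟩ => hl <| by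
        apply LinearMap.ext
        rintro ⟨t, x, s⟩
        rw [hlx, h0, h1, h2]
        simp)
      convert h using 2
      ext x
      simp only [mem_ofPred_eq]
      rw [hlx, one_mul, mul_comm (‖x‖ ^ 2)]) (d + 2) hE₂.ge
  filter_upwards [ae_forall_parkingSet_notMem hΦ hρ h₁, ae_forall_parkingSet_notMem hΦ hρ h₂]
    with ω hω₁ hω₂
  have henum : ∀ (n : ℕ) (s : Finset (Space d)), (s : Set (Space d)) ⊆ (parkingSet hρ (Φ ω)).carrier →
      s.card = n → ∃ x : Fin n → Space d, Function.Injective x ∧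
        (∀ i, x i ∈ (parkingSet hρ (Φ ω)).carrier) ∧ ∀ i, x i ∈ s := fun n s hs hn =>
    ⟨fun i => ((s.equivFinOfCardEq hn).symm i).1,
      fun i j hij => (s.equivFinOfCardEq hn).symm.injective (Subtype.ext hij),
      fun i => hs ((s.equivFinOfCardEq hn).symm i).2, fun i => ((s.equivFinOfCardEq hn).symm i).2⟩
  constructor
  · rintro s hs hcard ⟨a, b, ha, hab⟩
    obtain ⟨x, hx, hxξ, hxs⟩ := henum _ s hs hcard
    have hli := not_not.1 (hω₁ x hx hxξ)
    -- The functional `(t, x) ↦ ⟪a, x⟫ - b t`; its value at `(0, a)` is `‖a‖ ^ 2`.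
    let l : ℝ × Space d →ₗ[ℝ] ℝ := LinearMap.coprod (-b • LinearMap.id) (innerₛₗ ℝ a)
    have hl : l = 0 := hli.eq_zero_of_apply_eq_zero hE₁.symm fun i => by
      simp [l, hab _ (hxs i)]
    have := LinearMap.congr_fun hl (0, a)
    simp [l] at this
    exact ha this
  · rintro s hs hcard ⟨c, r, hc⟩
    obtain ⟨x, hx, hxξ, hxs⟩ := henum _ s hs hcard
    have hli := not_not.1 (hω₂ x hx hxξ)
    -- The expansion of `‖x - c‖ ^ 2 - r ^ 2`; the coefficient of the last coordinate is `1`, so the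
    -- functional is nonzero.
    let l : ℝ × Space d × ℝ →ₗ[ℝ] ℝ := LinearMap.coprod ((‖c‖ ^ 2 - r ^ 2) • LinearMap.id)
      (LinearMap.coprod (-(2 : ℝ) • innerₛₗ ℝ c) LinearMap.id)
    have hl : l = 0 := hli.eq_zero_of_apply_eq_zero hE₂.symm fun i => by
      have h1 := hc _ (hxs i)
      rw [dist_eq_norm] at h1
      have h2 := norm_sub_sq_real (x i) c
      rw [h1, real_inner_comm] at h2
      simp [l]
      linarith
    have := LinearMap.congr_fun hl (0, 0, 1)
    simp [l] at this

/-! ### Every vertex is eventually accepted or rejected -/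

namespace Parking

variable {d : ℕ}

/-- The chains of `n` arrivals below `q`: each one is within distance `2 * ρ` of its predecessor
and not later. -/
def descending (ρ : ℝ) : (n : ℕ) → SpaceTime d → Set (Fin n → SpaceTime d)
  | 0, _ => univ
  | n + 1, q => {p | p 0 ∈ Metric.ball q.1 (2 * ρ) ×ˢ Iic q.2 ∧
      Fin.tail p ∈ descending ρ n (p 0)}

theorem measurableSet_descending (ρ : ℝ) (n : ℕ) :
    MeasurableSet {z : SpaceTime d × (Fin n → SpaceTime d) | z.2 ∈ descending ρ n z.1} := by
  induction n with
  | zero => exact MeasurableSet.univ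
  | succ n ih =>
    have h0 : Measurable fun z : SpaceTime d × (Fin (n + 1) → SpaceTime d) => z.2 0 :=
      (measurable_pi_apply 0).comp measurable_snd
    have ht : Measurable fun z : SpaceTime d × (Fin (n + 1) → SpaceTime d) => Fin.tail z.2 :=
      measurable_pi_lambda _ fun i => (measurable_pi_apply i.succ).comp measurable_snd
    have h1 : MeasurableSet {z : SpaceTime d × (Fin (n + 1) → SpaceTime d) |
        dist (z.2 0).1 z.1.1 < 2 * ρ} :=
      measurableSet_lt (h0.fst.dist measurable_fst.fst) measurable_const
    have h2 : MeasurableSet {z : SpaceTime d × (Fin (n + 1) → SpaceTime d) |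
        (z.2 0).2 ≤ z.1.2} :=
      measurableSet_le (f := fun z : SpaceTime d × (Fin (n + 1) → SpaceTime d) => (z.2 0).2)
        (g := fun z => z.1.2) h0.snd measurable_fst.snd
    exact (h1.inter h2).inter ((h0.prodMk ht) ih)

theorem lintegral_pow_timeVolume (n : ℕ) (t : ℝ≥0) :
    ∫⁻ s in Iic t, (s : ℝ≥0∞) ^ n ∂timeVolume = (t : ℝ≥0∞) ^ (n + 1) / (n + 1) := by
  have hmap : (timeVolume.restrict (Iic t)).map (fun s : ℝ≥0 => (s : ℝ))
      = volume.restrict (Icc 0 (t : ℝ)) := by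
    ext B hB
    rw [measurableEmbedding_nnrealCoe.map_apply, Measure.restrict_apply
      (measurableEmbedding_nnrealCoe.measurable hB), timeVolume_apply, Measure.restrict_apply hB]
    congr 1
    ext x
    constructor
    · rintro ⟨s, ⟨hs, hst⟩, rfl⟩
      exact ⟨hs, s.2, hst⟩
    · rintro ⟨hx, h0, hxt⟩
      exact ⟨⟨x, h0⟩, ⟨hx, hxt⟩, rfl⟩
  calc ∫⁻ s in Iic t, (s : ℝ≥0∞) ^ n ∂timeVolume
      = ∫⁻ x in Icc 0 (t : ℝ), ENNReal.ofReal (x ^ n) := by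
        rw [← hmap, measurableEmbedding_nnrealCoe.lintegral_map]
        simp [ENNReal.ofReal_pow]
    _ = ENNReal.ofReal (∫ x in Icc 0 (t : ℝ), x ^ n) := by
        refine (ofReal_integral_eq_lintegral_ofReal ?_ ?_).symm
        · exact (continuous_pow n).continuousOn.integrableOn_Icc
        · filter_upwards [ae_restrict_mem measurableSet_Icc] with x hx
          exact pow_nonneg hx.1 n
    _ = _ := by
        rw [integral_Icc_eq_integral_Ioc, ← intervalIntegral.integral_of_le (NNReal.coe_nonneg t), integral_pow,
          zero_pow (Nat.succ_ne_zero n), sub_zero, ENNReal.ofReal_div_of_pos (by positivity),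
          ENNReal.ofReal_pow t.coe_nonneg, ENNReal.ofReal_coe_nnreal,
          ENNReal.ofReal_add (by positivity) zero_le_one, ENNReal.ofReal_natCast,
          ENNReal.ofReal_one]

/-- Each link contributes the volume of a ball in space, and the ordered times contribute the volume
`t ^ n / n!` of a simplex. -/
theorem pi_descending_le (ρ : ℝ) (n : ℕ) (q : SpaceTime d) :
    Measure.pi (fun _ : Fin n => spaceTimeVolume d) (descending ρ n q)
      ≤ (volume (Metric.ball (0 : Space d) (2 * ρ)) * q.2) ^ n / n.factorial := by
  induction n generalizing q with
  | zero => simp [descending]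
  | succ n ih =>
    have hmeas : MeasurableSet (descending ρ (n + 1) q) :=
      measurable_prodMk_left (x := q) (measurableSet_descending ρ (n + 1))
    have hp := measurePreserving_piFinSuccAbove (fun _ : Fin (n + 1) => spaceTimeVolume d) 0
    rw [← (hp.symm).measure_preimage hmeas.nullMeasurableSet,
      Measure.prod_apply (hp.symm.measurable hmeas)]
    set c := volume (Metric.ball (0 : Space d) (2 * ρ)) with hc
    have hsec : ∀ y : SpaceTime d, Measure.pi (fun _ : Fin n => spaceTimeVolume d) (Prod.mk y ⁻¹'
        ((MeasurableEquiv.piFinSuccAbove (fun _ : Fin (n + 1) => SpaceTime d) 0).symm ⁻¹'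
          descending ρ (n + 1) q)) ≤
        (Metric.ball q.1 (2 * ρ)).indicator (fun _ => 1) y.1 *
          (Iic q.2).indicator (fun s : ℝ≥0 => (c * s) ^ n / n.factorial) y.2 := by
      intro y
      by_cases hy : y ∈ Metric.ball q.1 (2 * ρ) ×ˢ Iic q.2
      · rw [indicator_of_mem hy.1, indicator_of_mem hy.2, one_mul]
        exact (measure_mono fun x hx => hx.2).trans (ih y)
      · refine (measure_mono_null (fun x hx => ?_) measure_empty).trans_le zero_le
        exact hy hx.1
    refine (lintegral_mono hsec).trans ?_
    rw [spaceTimeVolume_eq_prod, lintegral_prod_mul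
      (measurable_const.indicator Metric.isOpen_ball.measurableSet).aemeasurable
      (Measurable.indicator (by fun_prop) measurableSet_Iic).aemeasurable,
      lintegral_indicator Metric.isOpen_ball.measurableSet, lintegral_indicator measurableSet_Iic,
      setLIntegral_one, Measure.addHaar_ball_center, ← hc]
    simp only [mul_pow, div_eq_mul_inv]
    rw [lintegral_mul_const _ (by fun_prop), lintegral_const_mul _ (by fun_prop),
      lintegral_pow_timeVolume, Nat.factorial_succ, Nat.cast_mul, div_eq_mul_inv,
      ENNReal.mul_inv (by simp) (by simp), Nat.cast_add_one]
    refine le_of_eq ?_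
    ring

/-- `p` arrives before `q`, where ties are broken lexicographically. -/
def Precedes (p q : SpaceTime d) : Prop := p.2 < q.2 ∨ (p.2 = q.2 ∧ LexLT p.1 q.1)

theorem Precedes.irrefl (p : SpaceTime d) : ¬ Precedes p p := by
  rintro (h | ⟨-, h⟩)
  · exact lt_irrefl _ h
  · exact lexLT_irrefl _ h

theorem LexLT.trans {x y z : Space d} (hxy : LexLT x y) (hyz : LexLT y z) : LexLT x z :=
  lt_trans (a := toLex fun i => x i) (b := toLex fun i => y i) (c := toLex fun i => z i) hxy hyz

theorem Precedes.trans {p q r : SpaceTime d} (hpq : Precedes p q) (hqr : Precedes q r) :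
    Precedes p r := by
  rcases hpq with h | ⟨h, h'⟩ <;> rcases hqr with k | ⟨k, k'⟩
  · exact Or.inl (h.trans k)
  · exact Or.inl (k ▸ h)
  · exact Or.inl (h ▸ k)
  · exact Or.inr ⟨h.trans k, h'.trans k'⟩

/-- A vertex that survives a round was not a root in it, hence has a parent that was still present;
iterating gives the chain. Strict precedence keeps its members distinct, as the first-moment bound
requires. -/
theorem exists_descending_of_mem_remaining {ρ : ℝ} {V : Set (SpaceTime d)} (n : ℕ) :
    ∀ p ∈ remaining ρ V n, ∃ c ∈ descending ρ n p, Function.Injective c ∧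
      (∀ i, c i ∈ V) ∧ ∀ i, Precedes (c i) p := by
  induction n with
  | zero =>
    exact fun p _ => ⟨Fin.elim0, trivial, fun i => i.elim0, fun i => i.elim0, fun i => i.elim0⟩
  | succ n ih =>
    intro p hp
    have hroot : p ∉ roots ρ (remaining ρ V n) := fun h => hp.2 (Or.inl h)
    obtain ⟨q, hq, he⟩ : ∃ q ∈ remaining ρ V n, Edge ρ q p := by
      by_contra! h
      exact hroot ⟨hp.1, h⟩
    obtain ⟨c, hc, hinj, hV, hprec⟩ := ih q hq
    have he' := edge_iff.1 he
    refine ⟨Fin.cons q c, ⟨⟨?_, ?_⟩, ?_⟩, ?_, ?_, ?_⟩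
    · exact he'.1
    · rcases he'.2 with h | h
      · exact h.le
      · exact h.1.le
    · simpa using hc
    · refine Fin.cons_injective_iff.2 ⟨?_, hinj⟩
      rintro ⟨i, hi⟩
      exact Precedes.irrefl q (hi ▸ hprec i)
    · refine Fin.cases ?_ fun i => ?_
      · exact remaining_subset ρ V n hq
      · exact hV i
    · refine Fin.cases ?_ fun i => ?_
      · exact he'.2
      · exact (hprec i).trans he'.2

variable {Ω : Type*} [MeasurableSpace Ω] {P : Measure Ω} {Φ : Ω → LocFinSet (SpaceTime d)}

theorem ae_exists_notMem_remaining (hΦ : IsPoissonProcess P (spaceTimeVolume d) Φ) (ρ : ℝ) :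
    ∀ᵐ ω ∂P, ∀ p ∈ (Φ ω).carrier, ∃ n, p ∉ remaining ρ (Φ ω).carrier n := by
  have key : ∀ T : ℕ, ∀ᵐ ω ∂P, ∀ p ∈ (Φ ω).carrier,
      p ∈ Metric.ball (0 : Space d) T ×ˢ Iic (T : ℝ≥0) →
      ∃ n, p ∉ remaining ρ (Φ ω).carrier n := by
    intro T
    set K : Set (SpaceTime d) := Metric.ball (0 : Space d) T ×ˢ Iic (T : ℝ≥0) with hK
    have hKm : MeasurableSet K := Metric.isOpen_ball.measurableSet.prod measurableSet_Iic
    have hKfin : spaceTimeVolume d K ≠ ∞ :=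
      spaceTimeVolume_ne_top _ (Metric.isBounded_ball.prod
        ((Metric.isBounded_Icc 0 (T : ℝ≥0)).subset fun s hs => ⟨zero_le, hs⟩))
    set c := volume (Metric.ball (0 : Space d) (2 * ρ)) with hc
    have hcfin : c ≠ ∞ := measure_ball_lt_top.ne
    have hbound : ∀ n : ℕ, P {ω | ∃ p ∈ (Φ ω).carrier, p ∈ K ∧
        ∀ n, p ∈ remaining ρ (Φ ω).carrier n} ≤
        (c * T) ^ n / n.factorial * spaceTimeVolume d K := by
      intro n
      -- Chains that start in `K`: index `0` carries the surviving vertex itself, the tail its `n`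
      -- ancestors.
      let A : Set (Fin (n + 1) → SpaceTime d) := {p | p 0 ∈ K ∧ Fin.tail p ∈ descending ρ n (p 0)}
      have hA : MeasurableSet A := by
        have h0 : Measurable fun z : Fin (n + 1) → SpaceTime d => z 0 := measurable_pi_apply 0
        have ht : Measurable fun z : Fin (n + 1) → SpaceTime d => Fin.tail z :=
          measurable_pi_lambda _ fun i => measurable_pi_apply i.succ
        exact (h0 hKm).inter ((h0.prodMk ht) (measurableSet_descending ρ n))
      calc _ ≤ P {ω | ∃ p ∈ A, Function.Injective p ∧ ∀ i, p i ∈ (Φ ω).carrier} := by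
            refine measure_mono ?_
            rintro ω ⟨p, hp, hpK, hpn⟩
            obtain ⟨x, hx, hinj, hxV, hprec⟩ := exists_descending_of_mem_remaining n p (hpn n)
            refine ⟨Fin.cons p x, ⟨hpK, by simpa using hx⟩, Fin.cons_injective_iff.2 ⟨?_, hinj⟩,
              Fin.cases hp hxV⟩
            rintro ⟨i, hi⟩
            exact Precedes.irrefl p (hi ▸ hprec i)
        _ ≤ Measure.pi (fun _ : Fin (n + 1) => spaceTimeVolume d) A :=
            hΦ.measure_exists_injective_le spaceTimeVolume_ne_top hA
        _ ≤ ∫⁻ y, K.indicator (fun _ => (c * T) ^ n / n.factorial) y ∂spaceTimeVolume d := by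
            have hp := measurePreserving_piFinSuccAbove
              (fun _ : Fin (n + 1) => spaceTimeVolume d) 0
            rw [← (hp.symm).measure_preimage hA.nullMeasurableSet,
              Measure.prod_apply (hp.symm.measurable hA)]
            refine lintegral_mono fun y => ?_
            by_cases hy : y ∈ K
            · rw [indicator_of_mem hy]
              refine (measure_mono fun x hx => hx.2).trans ((pi_descending_le ρ n y).trans ?_)
              have hyT : (y.2 : ℝ≥0∞) ≤ T := by exact_mod_cast hy.2
              rw [← hc]
              gcongr
            · refine (measure_mono_null (fun x hx => ?_) measure_empty).trans_le zero_le
              exact hy hx.1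
        _ = _ := lintegral_indicator_const hKm _
    have hlim : Filter.Tendsto (fun n : ℕ => (c * T) ^ n / n.factorial * spaceTimeVolume d K)
        Filter.atTop (nhds 0) := by
      have hcT : c * T ≠ ∞ := by finiteness
      have h := ENNReal.Tendsto.mul_const (b := spaceTimeVolume d K)
        ((ENNReal.continuous_ofReal.tendsto 0).comp
          (FloorSemiring.tendsto_pow_div_factorial_atTop (c * T).toReal)) (Or.inr hKfin)
      rw [ENNReal.ofReal_zero, zero_mul] at h
      refine h.congr fun n => ?_
      rw [Function.comp_apply, ENNReal.ofReal_div_of_pos (by positivity),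
        ENNReal.ofReal_pow ENNReal.toReal_nonneg, ENNReal.ofReal_toReal hcT, ENNReal.ofReal_natCast]
    have hzero := le_antisymm (ge_of_tendsto' hlim hbound) zero_le
    filter_upwards [measure_eq_zero_iff_ae_notMem.1 hzero] with ω hω p hp hpK
    by_contra! h
    exact hω ⟨p, hp, hpK, h⟩
  filter_upwards [ae_all_iff.2 key] with ω hω p hp
  obtain ⟨T, hT⟩ := exists_nat_gt (max ‖p.1‖ p.2)
  refine hω T p hp ⟨?_, ?_⟩
  · rw [mem_ball_zero_iff]
    exact (le_max_left _ _).trans_lt hT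
  · have := (le_max_right _ _).trans hT.le
    exact_mod_cast this

/-- In the round in which `p` disappears it is a root, hence accepted, or the offspring of an
accepted root within distance `2 * ρ`. -/
theorem exists_accepted_near {ρ : ℝ} (hρ : 0 < ρ) {V : Set (SpaceTime d)} {p : SpaceTime d}
    (hp : p ∈ V) (hn : ∃ n, p ∉ remaining ρ V n) :
    ∃ q ∈ accepted ρ V, dist q.1 p.1 < 2 * ρ := by
  classical
  obtain ⟨m, hm⟩ : ∃ m, Nat.find hn = m + 1 := by
    refine Nat.exists_eq_succ_of_ne_zero fun h0 => ?_
    have := Nat.find_spec hn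
    rw [h0] at this
    exact this hp
  have h1 : p ∈ remaining ρ V m := not_not.1 (Nat.find_min hn (m := m) (by omega))
  have h2 := Nat.find_spec hn
  rw [hm] at h2
  by_cases hr : p ∈ roots ρ (remaining ρ V m)
  · exact ⟨p, mem_iUnion.2 ⟨m, hr⟩, by rw [dist_self]; positivity⟩
  · by_cases ho : p ∈ offspring ρ (remaining ρ V m)
    · obtain ⟨-, q, hq, he⟩ := ho
      exact ⟨q, mem_iUnion.2 ⟨m, hq⟩, (edge_iff.1 he).1⟩
    · exact absurd ⟨h1, fun h => h.elim hr ho⟩ h2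

/-! ### Void probabilities and density of the arrivals -/

theorem measure_count_eq_zero {X : Type*} [MetricSpace X] [MeasurableSpace X]
    {μ : Measure X} {Ψ : Ω → LocFinSet X} (h : IsPoissonProcess P μ Ψ) {B : Set X}
    (hB : MeasurableSet B) (hμ : μ B ≠ ∞) :
    P {ω | (Ψ ω).carrier ∩ B = ∅} = ENNReal.ofReal (Real.exp (-(μ B).toReal)) := by
  have hm := h.measurable_count hB
  have h1 : {ω | (Ψ ω).carrier ∩ B = ∅} = (fun ω => (Ψ ω).count B) ⁻¹' {0} := by
    ext ω
    simp [LocFinSet.count]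
  rw [h1, ← Measure.map_apply hm (measurableSet_singleton _), h.map_count B hB hμ,
    Measure.map_apply .of_discrete (measurableSet_singleton _)]
  have h2 : (fun n : ℕ => (n : ℕ∞)) ⁻¹' {0} = {0} := by ext n; simp
  rw [h2, poissonMeasure_singleton, pow_zero, mul_one, Nat.factorial_zero, Nat.cast_one, div_one]
  rfl

theorem ae_exists_mem_fst (hΦ : IsPoissonProcess P (spaceTimeVolume d) Φ) {O : Set (Space d)}
    (hO : IsOpen O) (hne : O.Nonempty) : ∀ᵐ ω ∂P, ∃ p ∈ (Φ ω).carrier, p.1 ∈ O := by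
  obtain ⟨x, hx⟩ := hne
  -- Intersecting with a ball makes the volume finite; the cylinders over `O'` up to time `n` then
  -- have finite volume tending to infinity.
  set O' := O ∩ Metric.ball x 1
  have hO' : IsOpen O' := hO.inter Metric.isOpen_ball
  have hpos : 0 < volume O' := hO'.measure_pos volume ⟨x, hx, Metric.mem_ball_self one_pos⟩
  have hfin : volume O' ≠ ∞ := (Metric.isBounded_ball.subset inter_subset_right).measure_lt_top.ne
  have hbound : ∀ n : ℕ, P {ω | ¬ ∃ p ∈ (Φ ω).carrier, p.1 ∈ O}
      ≤ ENNReal.ofReal (Real.exp (-((volume O').toReal * n))) := by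
    intro n
    have hvol : spaceTimeVolume d (O' ×ˢ Iic (n : ℝ≥0)) = volume O' * n := by
      rw [spaceTimeVolume_eq_prod, Measure.prod_prod, timeVolume_Iic]
      simp
    have h := measure_count_eq_zero hΦ (hO'.measurableSet.prod (measurableSet_Iic (a := (n : ℝ≥0))))
      (by rw [hvol]; finiteness)
    rw [hvol, ENNReal.toReal_mul, ENNReal.toReal_natCast] at h
    rw [← h]
    refine measure_mono fun ω hω => ?_
    refine Set.eq_empty_iff_forall_notMem.2 fun p hp => hω ⟨p, hp.1, hp.2.1.1⟩
  have hlim : Filter.Tendsto (fun n : ℕ => ENNReal.ofReal (Real.exp (-((volume O').toReal * n))))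
      Filter.atTop (nhds 0) := by
    rw [← ENNReal.ofReal_zero]
    refine (ENNReal.continuous_ofReal.tendsto 0).comp
      (Real.tendsto_exp_neg_atTop_nhds_zero.comp ?_)
    exact tendsto_natCast_atTop_atTop.const_mul_atTop (ENNReal.toReal_pos hpos.ne' hfin)
  exact le_antisymm (ge_of_tendsto' hlim hbound) zero_le

/-- Almost surely, the points at distance less than `2 * ρ` from the parking set are dense. -/
theorem ae_dense_parkingSet (hΦ : IsPoissonProcess P (spaceTimeVolume d) Φ) {ρ : ℝ} (hρ : 0 < ρ) :
    ∀ᵐ ω ∂P, Dense {x | ∃ y ∈ (parkingSet hρ (Φ ω)).carrier, dist y x < 2 * ρ} := by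
  have h := (ae_ball_iff (TopologicalSpace.countable_countableBasis (Space d))).2 fun O hO =>
    ae_exists_mem_fst hΦ (TopologicalSpace.isOpen_of_mem_countableBasis hO)
      (TopologicalSpace.nonempty_of_mem_countableBasis hO)
  filter_upwards [h, ae_exists_notMem_remaining hΦ ρ] with ω h1 h2
  refine (TopologicalSpace.isBasis_countableBasis (Space d)).dense_iff.2 fun O hO _ => ?_
  obtain ⟨p, hp, hpO⟩ := h1 O hO
  obtain ⟨q, hq, hqp⟩ := exists_accepted_near hρ hp (h2 p hp)
  exact ⟨p.1, hpO, q.1, ⟨q, hq, rfl⟩, hqp⟩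

end Parking

/-! ### Absence of holes of critical size -/

/-- The tuples of points on a sphere of radius `R` whose centre lies in their convex hull. -/
def centredTuples (d k : ℕ) (R : ℝ) : Set (Fin k → Space d) :=
  {x | ∃ w ∈ stdSimplex ℝ (Fin k), ∀ i, dist (∑ j, w j • x j) (x i) = R}

/-- The weights range over a compact simplex, so projecting them away preserves closedness. -/
theorem isClosed_centredTuples (d k : ℕ) (R : ℝ) : IsClosed (centredTuples d k R) := by
  have : CompactSpace (stdSimplex ℝ (Fin k)) :=
    isCompact_iff_compactSpace.1 (isCompact_stdSimplex ℝ (Fin k))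
  have h : IsClosed {z : (Fin k → Space d) × stdSimplex ℝ (Fin k) |
      ∀ i, dist (∑ j, z.2.1 j • z.1 j) (z.1 i) = R} := by
    simp only [ofPred_forall]
    refine isClosed_iInter fun i => isClosed_eq (Continuous.dist ?_ (by fun_prop)) (by fun_prop)
    refine continuous_finsetSum _ fun j _ => ?_
    have h1 : Continuous fun z : (Fin k → Space d) × stdSimplex ℝ (Fin k) => z.2.1 j :=
      (continuous_apply j).comp (continuous_subtype_val.comp continuous_snd)
    exact h1.smul ((continuous_apply j).comp continuous_fst)
  convert isClosedMap_fst_of_compactSpace _ h using 1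
  ext x
  constructor
  · rintro ⟨w, hw, hx⟩
    exact ⟨(x, ⟨w, hw⟩), hx, rfl⟩
  · rintro ⟨⟨x, w⟩, hx, rfl⟩
    exact ⟨w.1, w.2, hx⟩

theorem smul_centredTuples (d k : ℕ) (R : ℝ) {c : ℝ} (hc : 0 < c) :
    (c • ·) '' centredTuples d k R ⊆ centredTuples d k (c * R) := by
  rintro _ ⟨x, ⟨w, hw, hx⟩, rfl⟩
  refine ⟨w, hw, fun i => ?_⟩
  have : ∑ j, w j • (c • x) j = c • ∑ j, w j • x j := by
    simp only [Pi.smul_apply, Finset.smul_sum]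
    exact Finset.sum_congr rfl fun j _ => smul_comm _ _ _
  change dist (∑ j, w j • (c • x) j) (c • x i) = c * R
  rw [this, dist_smul₀, hx i, Real.norm_of_nonneg hc.le]

/-- For two such centres `z`, `z'`, the map `⟪z - z', ·⟫` is constant on the points, hence on their
convex hull, which contains both centres. So `‖z - z'‖ ^ 2 = 0`, and the radii agree. -/
theorem disjoint_centredTuples (d k : ℕ) {R R' : ℝ} (h : R ≠ R') :
    Disjoint (centredTuples d k R) (centredTuples d k R') := by
  refine Set.disjoint_left.2 ?_
  rintro x ⟨w, hw, hx⟩ ⟨w', hw', hx'⟩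
  set z := ∑ j, w j • x j with hz
  set z' := ∑ j, w' j • x j with hz'
  have hi : ∀ i, inner ℝ (z - z') (x i) = (‖z‖ ^ 2 - ‖z'‖ ^ 2 - R ^ 2 + R' ^ 2) / 2 := fun i => by
    have h1 := norm_sub_sq_real z (x i)
    have h2 := norm_sub_sq_real z' (x i)
    rw [← dist_eq_norm, hx i] at h1
    rw [← dist_eq_norm, hx' i] at h2
    rw [inner_sub_left]
    linarith
  have hsum : ∀ v ∈ stdSimplex ℝ (Fin k), inner ℝ (z - z') (∑ j, v j • x j)
      = (‖z‖ ^ 2 - ‖z'‖ ^ 2 - R ^ 2 + R' ^ 2) / 2 := fun v hv => by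
    simp only [inner_sum, inner_smul_right, hi, ← Finset.sum_mul, hv.2, one_mul]
  have hzz : z = z' := by
    rw [← sub_eq_zero, ← inner_self_eq_zero (𝕜 := ℝ)]
    rw [inner_sub_right, hz, hsum w hw, hz', hsum w' hw', sub_self]
  obtain ⟨i⟩ : Nonempty (Fin k) := by
    by_contra hk
    rw [not_nonempty_iff] at hk
    have := hw.2
    simp at this
  exact h (by rw [← hx i, ← hx' i, hzz])

open scoped Pointwise in
-- By scaling, positive measure for one radius would give positive measure for every radius:
-- uncountably many disjoint sets of positive measure, impossible for a σ-finite measure.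
theorem volume_centredTuples (d k : ℕ) {R : ℝ} (hR : 0 < R) :
    volume (centredTuples d k R) = 0 := by
  by_contra hne
  have hcount := Measure.countable_meas_pos_of_disjoint_iUnion (μ := volume)
    (As := fun r : Ioi (0 : ℝ) => centredTuples d k r)
    (fun r => (isClosed_centredTuples d k r).measurableSet)
    (fun r r' hr => disjoint_centredTuples d k fun h => hr (Subtype.ext h))
  have hall : {r : Ioi (0 : ℝ) | 0 < volume (centredTuples d k r)} = univ := by
    refine eq_univ_of_forall fun r => ?_
    have hc : 0 < (r : ℝ) / R := div_pos r.2 hR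
    have h1 := smul_centredTuples d k R hc
    rw [div_mul_cancel₀ _ hR.ne'] at h1
    refine lt_of_lt_of_le ?_ (measure_mono h1)
    have h2 := Measure.addHaar_smul (volume : Measure (Fin k → Space d)) (r / R)
      (centredTuples d k R)
    rw [← image_smul] at h2
    rw [h2]
    refine ENNReal.mul_pos ?_ hne
    rw [ne_eq, ENNReal.ofReal_eq_zero, not_le]
    positivity
  rw [hall, countable_univ_iff, countable_coe_iff] at hcount
  have := hcount.measure_zero volume
  simp at this

theorem exists_dist_lt_of_dense {d : ℕ} {S : LocFinSet (Space d)} {r : ℝ} (hr : 0 < r)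
    (hdense : Dense {x | ∃ y ∈ S.carrier, dist y x < r})
    (hcentre : ∀ (k : ℕ) (x : Fin k → Space d), Function.Injective x →
      (∀ i, x i ∈ S.carrier) → x ∉ centredTuples d k r) (z : Space d) :
    ∃ y ∈ S.carrier, dist y z < r := by
  classical
  by_contra! hz
  -- Only points this close matter: a point within `r` of some `x` in the `r`-ball around `z` is
  -- within `2 * r` of `z`.
  have hF := S.finite_inter _ (Metric.isBounded_closedBall (x := z) (r := 3 * r))
  have hY : {y ∈ S.carrier | dist y z = r}.Finite := hF.subset fun y hy =>
    ⟨hy.1, by rw [Metric.mem_closedBall, hy.2]; linarith⟩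
  have hconv : z ∉ convexHull ℝ {y ∈ S.carrier | dist y z = r} := by
    intro hmem
    rw [← hY.coe_toFinset, Finset.mem_convexHull'] at hmem
    obtain ⟨w, hw0, hw1, hwz⟩ := hmem
    set e := hY.toFinset.equivFin
    have hsum : ∀ {M : Type} [AddCommMonoid M] (g : Space d → M),
        ∑ j, g (e.symm j).1 = ∑ y ∈ hY.toFinset, g y := fun g => by
      rw [e.symm.sum_comp fun y => g y.1, Finset.sum_coe_sort]
    refine hcentre _ (fun i => (e.symm i).1) (fun i j hij => e.symm.injective (Subtype.ext hij))
      (fun i => (hY.mem_toFinset.1 (e.symm i).2).1)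
      ⟨fun i => w (e.symm i).1, ⟨fun i => hw0 _ (e.symm i).2, ?_⟩, fun i => ?_⟩
    · rw [hsum w, hw1]
    · rw [hsum fun y => w y • y, hwz, dist_comm]
      exact (hY.mem_toFinset.1 (e.symm i).2).2
  -- A separating functional gives a direction: moving from `z` against its gradient `v` increases
  -- the distance to every point at distance exactly `r`, and a small move keeps the others farther
  -- than `r`.
  obtain ⟨f, u, hfz, hfY⟩ := geometric_hahn_banach_point_closed (convex_convexHull ℝ _)
    (hY.isClosed_convexHull ℝ) hconv
  set v := (InnerProductSpace.toDual ℝ (Space d)).symm f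
  have hv : ∀ y, inner ℝ v y = f y := fun y => by simp [v]
  have hcont : Filter.Tendsto (fun t : ℝ => z - t • v) (nhdsWithin 0 (Ioi 0)) (nhds z) := by
    have : Filter.Tendsto (fun t : ℝ => z - t • v) (nhds 0) (nhds (z - (0 : ℝ) • v)) :=
      Continuous.tendsto (by fun_prop) 0
    rw [zero_smul, sub_zero] at this
    exact this.mono_left nhdsWithin_le_nhds
  have hfar : ∀ y ∈ S.carrier ∩ Metric.closedBall z (3 * r),
      ∀ᶠ t in nhdsWithin (0 : ℝ) (Ioi 0), r < dist y (z - t • v) := by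
    intro y hy
    rcases (hz y hy.1).eq_or_lt with heq | hlt
    · filter_upwards [self_mem_nhdsWithin] with t ht
      have h1 : f z < f y := hfz.trans (hfY y (subset_convexHull ℝ _ ⟨hy.1, heq.symm⟩))
      have h2 : ‖y - (z - t • v)‖ ^ 2 = r ^ 2 + 2 * t * (f y - f z) + (t * ‖v‖) ^ 2 := by
        have h3 : y - (z - t • v) = (y - z) + t • v := by abel
        rw [h3, norm_add_sq_real, ← dist_eq_norm, ← heq, inner_smul_right, real_inner_comm,
          hv, map_sub, norm_smul, mul_pow, mul_pow, Real.norm_eq_abs, sq_abs]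
        ring
      rw [dist_eq_norm]
      refine lt_of_pow_lt_pow_left₀ 2 (norm_nonneg _) ?_
      rw [h2]
      have : 0 < t * (f y - f z) := mul_pos ht (sub_pos.2 h1)
      nlinarith [sq_nonneg (t * ‖v‖)]
    · exact (tendsto_const_nhds.dist hcont).eventually (lt_mem_nhds hlt)
  obtain ⟨t, htfar, htball⟩ := (((Filter.eventually_all_finite hF).2 hfar).and
    (hcont.eventually (Metric.ball_mem_nhds z hr))).exists
  -- Finiteness makes the uncovered region open, so density places a covered point in it, a
  -- contradiction.
  have hopen : IsOpen (⋂ y ∈ S.carrier ∩ Metric.closedBall z (3 * r), {x | r < dist y x}) :=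
    hF.isOpen_biInter fun y _ => isOpen_lt continuous_const (by fun_prop)
  obtain ⟨x, ⟨hxfar, hxball⟩, y, hyS, hyx⟩ := hdense.inter_open_nonempty _
    (hopen.inter Metric.isOpen_ball) ⟨z - t • v, mem_iInter₂.2 htfar, htball⟩
  by_cases hy : y ∈ Metric.closedBall z (3 * r)
  · exact (mem_iInter₂.1 hxfar y ⟨hyS, hy⟩).not_gt hyx
  · rw [Metric.mem_closedBall, not_le] at hy
    rw [Metric.mem_ball] at hxball
    linarith [dist_triangle y x z]

theorem Parking.ae_isAdmissible_parkingSet {d : ℕ} {ρ : ℝ} {Ω : Type*}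
    [MeasurableSpace Ω] {P : Measure Ω} {Φ : Ω → LocFinSet (SpaceTime d)}
    (hΦ : IsPoissonProcess P (spaceTimeVolume d) Φ) (hρ : 0 < ρ) :
    ∀ᵐ ω ∂P, IsAdmissible (2 * ρ) (2 * ρ) (parkingSet hρ (Φ ω)).carrier := by
  have hr : 0 < 2 * ρ := mul_pos two_pos hρ
  filter_upwards [ae_dense_parkingSet hΦ hρ, ae_all_iff.2 fun k =>
    ae_forall_parkingSet_notMem hΦ hρ (volume_centredTuples d k hr)] with ω h1 h2
  refine ⟨fun x hx y hy hne => accepted_separated ρ _ hx hy hne, fun z => ?_⟩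
  obtain ⟨y, hy, hyz⟩ := exists_dist_lt_of_dense hr h1 h2 z
  exact ⟨y, hyz, hy⟩

theorem mainTheorem2 {Ω : Type*} [MeasurableSpace Ω] (P : Measure Ω) [IsProbabilityMeasure P]
    (d : ℕ) (hd : 1 ≤ d) (ρ₀ : ℝ) (hρ₀ : 0 < ρ₀)
    (Φ : Ω → LocFinSet (SpaceTime d))
    (hΦ : IsPoissonProcess P (spaceTimeVolume d) Φ)
    (ξ : Ω → LocFinSet (Space d))
    (hξ : ∀ ω, ξ ω = Parking.parkingSet hρ₀ (Φ ω)) :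
    Measurable ξ ∧
    PointProcess.IsStationary P ξ ∧
    ErgodicVAdd (Space d) (LocFinSet (Space d)) (P.map ξ) ∧
    PointProcess.IsIsotropic P ξ ∧
    (∀ᵐ ω ∂P, IsGeneral (ξ ω).carrier) ∧
    (∀ᵐ ω ∂P, IsAdmissible (2 * ρ₀) (2 * ρ₀) (ξ ω).carrier) := by
  obtain rfl : ξ = fun ω => Parking.parkingSet hρ₀ (Φ ω) := funext hξ
  exact ⟨(Parking.measurable_parkingSet hρ₀).comp hΦ.measurable,
    Parking.isStationary_parkingSet hΦ hρ₀, Parking.ergodicVAdd_parkingSet hΦ hρ₀ hd,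
    Parking.isIsotropic_parkingSet hΦ hρ₀, Parking.ae_isGeneral_parkingSet hd hΦ hρ₀,
    Parking.ae_isAdmissible_parkingSet hΦ hρ₀⟩
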